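/- Let $d\in\{2,3\}$, let $\Omega\subset\mathbb R^d$ be a bounded polyhedral domain (a bounded connected open set with $\Omega=\operatorname{int}\overline\Omega$ whose closure is a finite union of $d$-simplices), and let $\mathbb T_h$ be a conformal simplicial mesh of $\overline\Omega$, i.e. a finite set of closed $d$-simplices with union $\overline\Omega$ and pairwise disjoint interiors, any two of which meet in a common face (possibly empty). Let $\mathcal F_h^i$ be the set of interior faces (the $(d-1)$-dimensional faces shared by two simplices of $\mathbb T_h$) and $\mathcal F_h^\partial$ the set of boundary faces (those contained in $\partial\Omega$); for $F\in\mathcal F_h^\partial$ let $\boldsymbol n_F$ be the unit normal to $F$ pointing out of $\Omega$. Values of $H^1$-functions on faces are traces, $ds$ is the $(d-1)$-dimensional surface measure, and $\Pi_F^0\varphi=\frac1{|F|}\int_F\varphi\,ds$. The broken gradient $\boldsymbol\nabla_h\psi$ is defined by $(\boldsymbol\nabla_h\psi)|_T=\boldsymbol\nabla(\psi|_T)$ for $T\in\mathbb T_h$. The Crouzeix--Raviart space is $$V_h^{CR}=\Big\{\varphi\in L^\infty(\Omega):\ \varphi|_T \text{ is affine for all } T\in\mathbb T_h,\ \int_F[\![\varphi]\!]_F\,ds=0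 \text{ for all } F\in\mathcal F_h^i\Big\},$$ where $[\![\varphi]\!]_F$ is the difference of the values on $F$ of $\varphi$ from the two simplices that share $F$. The lowest-order Raviart--Thomas interpolant $\mathcal I_h^{RT}\boldsymbol w$ of $\boldsymbol w\in H^1(\Omega)^d$ is given on each $T\in\mathbb T_h$ with vertices $P_1,\dots,P_{d+1}$ by $$(\mathcal I_h^{RT}\boldsymbol w)|_T(x)=\sum_{i=1}^{d+1}\Big(\int_{F_i}\boldsymbol w\cdot\boldsymbol n_{i}\,ds\Big)\frac{x-P_i}{d\,|T|},$$ where $F_i$ is the face of $T$ opposite to $P_i$ and $\boldsymbol n_{i}$ is the unit normal to $F_i$ pointing out of $T$. Then for all $\boldsymbol w\in H^1(\Omega)^d$ and all $\psi_h\in V_h^{CR}+H^1(\Omega)$, the field $\mathcal I_h^{RT}\boldsymbol w$ lies in $L^2(\Omega)^d$ and has a weak divergence in $L^2(\Omega)$, all the integrals below converge, and $$\int_\Omega\big(\mathcal I_h^{RT}\boldsymbol w\cdot\boldsymbol\nabla_h\psi_h+\operatorname{div}(\mathcal I_h^{RT}\boldsymbol w)\,\psi_h\big)\,dx=\sum_{F\in\mathcal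 F_h^\partial}\int_F(\boldsymbol w\cdot\boldsymbol n_F)\,\Pi_F^0\psi_h\,ds.$$ -/

import Mathlib

open MeasureTheory Filter Topology
open scoped ContDiff RealInnerProductSpace ENNReal Pointwise

noncomputable section

namespace CRRT

/-- The space `ℝ^d` with its Euclidean norm. -/
abbrev Sp (d : ℕ) : Type := EuclideanSpace ℝ (Fin d)

/-- A (nondegenerate) `d`-simplex in `ℝ^d`, given by its `d + 1` vertices. -/
abbrev Simp (d : ℕ) : Type := Affine.Simplex ℝ (Sp d) d

/-! ### Weak derivatives and Sobolev spaces

Functions on an open set `U` are represented by functions on the whole of `ℝ^d`; only their values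
almost everywhere in `U` matter. -/

/-- Smooth test functions with compact support contained in `U`. -/
def IsTest {d : ℕ} (U : Set (Sp d)) (φ : Sp d → ℝ) : Prop :=
  ContDiff ℝ ∞ φ ∧ HasCompactSupport φ ∧ tsupport φ ⊆ U

/-- `g` is a weak gradient of `f` in `U`. -/
def HasWeakGrad {d : ℕ} (U : Set (Sp d)) (f : Sp d → ℝ) (g : Sp d → Sp d) : Prop :=
  ∀ φ : Sp d → ℝ, IsTest U φ →
    ∫ x in U, f x • gradient φ x = -∫ x in U, φ x • g x

/-- The Sobolev space `H¹(U)`: functions in `L²(U)` with a weak gradient in `L²(U)^d`. -/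
def H1 {d : ℕ} (U : Set (Sp d)) : Set (Sp d → ℝ) :=
  {f | MemLp f 2 (volume.restrict U) ∧
    ∃ g : Sp d → Sp d, MemLp g 2 (volume.restrict U) ∧ HasWeakGrad U f g}

/-- The space `H¹(U)^d` of vector fields. -/
def H1vec {d : ℕ} (U : Set (Sp d)) : Set (Sp d → Sp d) :=
  {w | ∀ j : Fin d, (fun x => w x j) ∈ H1 U}

open Classical in
/-- The square integrable weak gradient of `f` in `U` (unique up to null sets when it exists). -/
def weakGrad {d : ℕ} (U : Set (Sp d)) (f : Sp d → ℝ) : Sp d → Sp d :=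
  if h : ∃ g : Sp d → Sp d, MemLp g 2 (volume.restrict U) ∧ HasWeakGrad U f g
  then h.choose else 0

/-- `q` is a weak divergence of the vector field `v` in `U`. -/
def HasWeakDiv {d : ℕ} (U : Set (Sp d)) (v : Sp d → Sp d) (q : Sp d → ℝ) : Prop :=
  ∀ φ : Sp d → ℝ, IsTest U φ →
    ∫ x in U, ⟪v x, gradient φ x⟫ = -∫ x in U, q x * φ x

open Classical in
/-- The square integrable weak divergence of `v` in `U`
(unique up to null sets when it exists). -/
def weakDiv {d : ℕ} (U : Set (Sp d)) (v : Sp d → Sp d) : Sp d → ℝ :=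
  if h : ∃ q : Sp d → ℝ, MemLp q 2 (volume.restrict U) ∧ HasWeakDiv U v q
  then h.choose else 0

/-! ### Simplices, faces, normals and traces -/

/-- The closed simplex as a set. -/
def cell {d : ℕ} (T : Simp d) : Set (Sp d) := convexHull ℝ (Set.range T.points)

/-- The closed face of `T` opposite to its `i`-th vertex. -/
def face {d : ℕ} (T : Simp d) (i : Fin (d + 1)) : Set (Sp d) :=
  convexHull ℝ (T.points '' {i}ᶜ)

/-- The surface measure `ds` on the face: the `(d-1)`-dimensional Hausdorff measure, normalised so
as to agree with Lebesgue measure on `(d-1)`-dimensional Euclidean space. -/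
def faceMeasure {d : ℕ} (T : Simp d) (i : Fin (d + 1)) : Measure (Sp d) :=
  (Measure.euclideanHausdorffMeasure (d - 1) : Measure (Sp d)).restrict (face T i)

/-- The unit normal to the face opposite to the `i`-th vertex, pointing out of `T`. -/
def normal {d : ℕ} [NeZero d] (T : Simp d) (i : Fin (d + 1)) : Sp d :=
  (T.height i)⁻¹ • (T.altitudeFoot i - T.points i)

/-- `g ∈ L²(F)` is the trace on the face `F` of `T` of a function `f ∈ H¹(T)`: some sequence of
smooth functions converges to `f` in `H¹(T)` while its restrictions to `F` converge to `g` in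
`L²(F)`. -/
def IsFaceTrace {d : ℕ} (T : Simp d) (i : Fin (d + 1)) (f g : Sp d → ℝ) : Prop :=
  MemLp g 2 (faceMeasure T i) ∧
  ∃ u : ℕ → Sp d → ℝ, (∀ n, ContDiff ℝ ∞ (u n)) ∧
    Tendsto (fun n => eLpNorm (u n - f) 2 (volume.restrict (interior (cell T)))) atTop (𝓝 0) ∧
    Tendsto (fun n => eLpNorm (gradient (u n) - weakGrad (interior (cell T)) f) 2
      (volume.restrict (interior (cell T)))) atTop (𝓝 0) ∧
    Tendsto (fun n => eLpNorm (u n - g) 2 (faceMeasure T i)) atTop (𝓝 0)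

open Classical in
/-- The trace on a face of `T` of (the restriction to `T` of) `f`; for `f ∈ H¹(T)` it is unique up
to null sets of the face. -/
def faceTrace {d : ℕ} (T : Simp d) (i : Fin (d + 1)) (f : Sp d → ℝ) : Sp d → ℝ :=
  if h : ∃ g : Sp d → ℝ, IsFaceTrace T i f g then h.choose else 0

/-- The normal trace `w · n` on a face of `T`, with `n` pointing out of `T`. -/
def normalTrace {d : ℕ} [NeZero d] (T : Simp d) (i : Fin (d + 1)) (w : Sp d → Sp d) :
    Sp d → ℝ :=
  fun x => ∑ j : Fin d, faceTrace T i (fun y => w y j) x * normal T i j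

/-- The `L²`-projection `Π_F^0` of a function on the face onto the constants: the mean value. -/
def faceProj {d : ℕ} (T : Simp d) (i : Fin (d + 1)) (φ : Sp d → ℝ) : ℝ :=
  ⨍ x, φ x ∂(faceMeasure T i)

/-! ### Polyhedral domains and conformal simplicial meshes -/

/-- Bounded polyhedral domains: bounded, open, connected sets whose closure is a finite union of
`d`-simplices and which lie on one side of their boundary only (no slits or punctures). -/
structure IsPolyhedralDomain {d : ℕ} (Ω : Set (Sp d)) : Prop where
  isOpen : IsOpen Ω
  isConnected : IsConnected Ω
  isBounded : Bornology.IsBounded Ω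
  interior_closure : interior (closure Ω) = Ω
  polyhedral : ∃ S : Finset (Simp d), closure Ω = ⋃ T ∈ S, cell T

/-- Conformal simplicial meshes of the closure of `Ω`: finitely many `d`-simplices covering the
closure of `Ω`, without overlap, any two of which meet in a common face (possibly empty). -/
structure Mesh {d : ℕ} (Ω : Set (Sp d)) where
  cells : Finset (Simp d)
  cover : closure Ω = ⋃ T ∈ cells, cell T
  disjoint : ∀ T ∈ cells, ∀ T' ∈ cells, T ≠ T' →
    Disjoint (interior (cell T)) (interior (cell T'))
  conformal : ∀ T ∈ cells, ∀ T' ∈ cells, T ≠ T' →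
    cell T ∩ cell T' = convexHull ℝ (Set.range T.points ∩ Set.range T'.points)

open Classical in
/-- The boundary faces of the mesh. A boundary face belongs to exactly one simplex of the mesh, so
it is recorded as a pair (simplex of the mesh, index of the opposite vertex). -/
def Mesh.boundaryFaces {d : ℕ} {Ω : Set (Sp d)} (M : Mesh Ω) : Finset (Simp d × Fin (d + 1)) :=
  (M.cells ×ˢ Finset.univ).filter fun F => face F.1 F.2 ⊆ frontier Ω

/-- The broken gradient: on each simplex `T` the weak gradient of the restriction to `T`. -/
def Mesh.brokenGrad {d : ℕ} {Ω : Set (Sp d)} (M : Mesh Ω) (ψ : Sp d → ℝ) : Sp d → Sp d :=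
  fun x => ∑ T ∈ M.cells,
    (interior (cell T)).indicator (weakGrad (interior (cell T)) ψ) x

/-! ### The Crouzeix--Raviart space -/

/-- The space of bounded functions that are affine on each simplex of the mesh. -/
def Mesh.P1dc {d : ℕ} {Ω : Set (Sp d)} (M : Mesh Ω) : Set (Sp d → ℝ) :=
  {v | MemLp v ∞ (volume.restrict Ω) ∧
    ∀ T ∈ M.cells, ∃ p : Sp d →ᵃ[ℝ] ℝ, v =ᵐ[volume.restrict (cell T)] p}

/-- The Crouzeix--Raviart space: piecewise affine functions whose jumps have mean value zero on
every interior face, i.e. on every face shared by two different simplices. -/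
def Mesh.VCR {d : ℕ} {Ω : Set (Sp d)} (M : Mesh Ω) : Set (Sp d → ℝ) :=
  {v | v ∈ M.P1dc ∧
    ∀ T ∈ M.cells, ∀ T' ∈ M.cells, T ≠ T' → ∀ i i' : Fin (d + 1), face T i = face T' i' →
      ∫ x, (faceTrace T i v x - faceTrace T' i' v x) ∂(faceMeasure T i) = 0}

/-! ### The lowest-order Raviart--Thomas interpolation -/

/-- The local shape functions `θ_i(x) = (x - P_i) / (d |T|)`: the flux of `θ_i` out of `T` is `1`
through the face opposite to the vertex `P_i`, and `0` through the other faces. -/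
def rtShape {d : ℕ} (T : Simp d) (i : Fin (d + 1)) (x : Sp d) : Sp d :=
  ((d : ℝ) * volume.real (cell T))⁻¹ • (x - T.points i)

/-- The local interpolant `∑ i, (∫_{F_i} w · n ds) θ_i`. -/
def rtLocal {d : ℕ} [NeZero d] (T : Simp d) (w : Sp d → Sp d) (x : Sp d) : Sp d :=
  ∑ i : Fin (d + 1), (∫ y, normalTrace T i w y ∂(faceMeasure T i)) • rtShape T i x

/-- The global interpolant, equal to the local interpolant on (the interior of) each simplex. -/
def Mesh.rtInterp {d : ℕ} [NeZero d] {Ω : Set (Sp d)} (M : Mesh Ω) (w : Sp d → Sp d) :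
    Sp d → Sp d :=
  fun x => ∑ T ∈ M.cells, (interior (cell T)).indicator (rtLocal T w) x

end CRRT

end

noncomputable section

namespace CRRT

open scoped Convolution

/-! On a simplex `T` with vertex `P_i` and opposite face `F_i`, the field `x - P_i` has constant
divergence `d`; its outward normal component is the height `h_i` on `F_i` and `0` on the other
faces. Hence `∫_T ((x - P_i)·∇f + d f) = h_i ∫_{F_i} f`. For smooth `f` (`setIntegral_cell_green`)
this is the fundamental theorem of calculus along the rays from `P_i`, since `T` is a cone over
`F_i`.

The local interpolant combines these fields with coefficients `flux_i / (d |T|)`, and `h_i |F_i| = d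
|T|`. So its Green formula reads `∫_T (I w·∇f + div(I w) f) = ∑_i flux_i · mean_{F_i} f`
(`rtLocal_green`). In the sum over all simplices each interior face occurs twice, with opposite
fluxes and, for `f` in the Crouzeix–Raviart space plus `H¹`, with equal means. Only the boundary
faces survive (`Mesh.sum_faces_eq_sum_boundaryFaces`, `Mesh.rtInterp_green`). Taking a test function
for `f` shows that the piecewise constant divergence is the weak divergence on `Ω`.

The analytic work concerns traces. Smooth functions are dense in `H¹` of a star-shaped body, by
dilation followed by mollification, and a trace inequality obtained from Green's formula for `u²`
makes their face restrictions converge. Afterwards only integrals of traces matter, and Green's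
formula expresses these through the function and its weak gradient, so neither the choice of trace
nor its pointwise values play a role. Two simplices sharing a face form a set that is star-shaped
about a point of that face. One smooth sequence therefore serves both sides, which gives equal trace
integrals (`integral_faceTrace_eq_of_face_eq`). -/

/-! ### Barycentric coordinates -/

/-- The vertices of a nondegenerate simplex as an affine basis. -/
def vertexBasis {d : ℕ} (T : Simp d) : AffineBasis (Fin (d + 1)) ℝ (Sp d) where
  toFun := T.points
  ind' := T.independent
  tot' := (T.independent.affineSpan_eq_top_iff_card_eq_finrank_add_one).2 (by simp)

lemma vertexBasis_apply {d : ℕ} (T : Simp d) (j : Fin (d + 1)) : vertexBasis T j = T.points j := rfl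

lemma coe_vertexBasis {d : ℕ} (T : Simp d) : ⇑(vertexBasis T) = T.points := rfl

lemma mem_cell_iff {d : ℕ} (T : Simp d) (x : Sp d) :
    x ∈ cell T ↔ ∀ j, 0 ≤ (vertexBasis T).coord j x := by
  have h := (vertexBasis T).convexHull_eq_nonneg_coord
  rw [coe_vertexBasis] at h
  rw [cell, h]; rfl

lemma mem_interior_cell_iff {d : ℕ} (T : Simp d) (x : Sp d) :
    x ∈ interior (cell T) ↔ ∀ j, 0 < (vertexBasis T).coord j x := by
  have h := (vertexBasis T).interior_convexHull
  rw [coe_vertexBasis] at h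
  rw [cell, h]; rfl

lemma convex_cell {d : ℕ} (T : Simp d) : Convex ℝ (cell T) := convex_convexHull _ _

lemma isCompact_cell {d : ℕ} (T : Simp d) : IsCompact (cell T) :=
  (Set.finite_range _).isCompact_convexHull _

lemma isCompact_face {d : ℕ} (T : Simp d) (i : Fin (d + 1)) : IsCompact (face T i) :=
  (Set.toFinite _).isCompact_convexHull _

lemma interior_cell_nonempty {d : ℕ} (T : Simp d) : (interior (cell T)).Nonempty :=
  ⟨_, (vertexBasis T).centroid_mem_interior_convexHull⟩

lemma volume_cell_lt_top {d : ℕ} (T : Simp d) : volume (cell T) < ⊤ :=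
  (isCompact_cell T).measure_lt_top

lemma interior_cell_ae_eq {d : ℕ} (T : Simp d) : interior (cell T) =ᵐ[volume] cell T :=
  interior_ae_eq_of_null_frontier ((convex_cell T).addHaar_frontier _)

lemma coord_combo {d : ℕ} (T : Simp d) (j : Fin (d + 1)) (c x : Sp d) (s : ℝ) :
    (vertexBasis T).coord j (c + s • (x - c))
      = (1 - s) * (vertexBasis T).coord j c + s * (vertexBasis T).coord j x := by
  have : c + s • (x - c) = AffineMap.lineMap c x s := by
    rw [AffineMap.lineMap_apply]; simp [add_comm]
  rw [this, AffineMap.apply_lineMap, AffineMap.lineMap_apply]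
  simp; ring

lemma face_subset_cell {d : ℕ} (T : Simp d) (i : Fin (d + 1)) : face T i ⊆ cell T :=
  convexHull_mono (Set.image_subset_range _ _)

/-- Vanishing of a coordinate is an affine, hence convex, condition; conversely, dropping the
vanishing terms from the barycentric expansion leaves a convex combination of the chosen vertices.
Arbitrary vertex sets are allowed because conformity of a mesh produces hulls of arbitrary sets of
common vertices. -/
lemma mem_convexHull_image_vertices_iff {d : ℕ} (T : Simp d) (s : Set (Fin (d + 1))) (x : Sp d) :
    x ∈ convexHull ℝ (T.points '' s) ↔
      x ∈ cell T ∧ ∀ j ∉ s, (vertexBasis T).coord j x = 0 := by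
  constructor
  · intro hx
    refine ⟨convexHull_mono (Set.image_subset_range _ _) hx, fun j hj => ?_⟩
    have : convexHull ℝ (T.points '' s) ⊆ {y | (vertexBasis T).coord j y = 0} := by
      refine convexHull_min ?_ ?_
      · rintro _ ⟨k, hk, rfl⟩
        have : k ≠ j := fun h => hj (h ▸ hk)
        simpa [vertexBasis_apply] using (vertexBasis T).coord_apply_ne this.symm
      · exact (convex_singleton (0 : ℝ)).affine_preimage ((vertexBasis T).coord j)
    exact this hx
  · rintro ⟨hx, h0⟩
    rw [mem_cell_iff] at hx
    classical
    have hsum := (vertexBasis T).sum_coord_apply_eq_one x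
    have hx' := (vertexBasis T).linear_combination_coord_eq_self x
    have e1 : ∑ j ∈ Finset.univ.filter (· ∈ s), (vertexBasis T).coord j x = 1 := by
      rw [Finset.sum_filter_of_ne, hsum]
      intro j _ hj; by_contra h; exact hj (h0 j h)
    have e2 : ∑ j ∈ Finset.univ.filter (· ∈ s), (vertexBasis T).coord j x • T.points j = x := by
      rw [Finset.sum_filter_of_ne]
      · exact hx'
      intro j _ hj; by_contra h; exact hj (by rw [h0 j h, zero_smul])
    rw [← e2]
    exact (convex_convexHull ℝ _).sum_mem (fun j _ => hx j) e1 fun j hj =>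
      subset_convexHull _ _ ⟨j, (Finset.mem_filter.1 hj).2, rfl⟩

lemma mem_face_iff {d : ℕ} (T : Simp d) (i : Fin (d + 1)) (x : Sp d) :
    x ∈ face T i ↔ x ∈ cell T ∧ (vertexBasis T).coord i x = 0 := by
  rw [face, mem_convexHull_image_vertices_iff]; simp

/-! ### Normals and heights -/

section normals
variable {d : ℕ} [NeZero d] (T : Simp d) (i : Fin (d + 1))

lemma norm_normal : ‖normal T i‖ = 1 := by
  have h := T.height_pos i
  rw [normal, norm_smul, norm_inv, Real.norm_of_nonneg h.le]
  rw [show ‖T.altitudeFoot i - T.points i‖ = T.height i by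
    rw [Affine.Simplex.height, dist_eq_norm_vsub', vsub_eq_sub]]
  exact inv_mul_cancel₀ h.ne'

lemma inner_normal_vertex {j : Fin (d + 1)} (hj : j ≠ i) :
    ⟪normal T i, T.points j - T.points i⟫ = T.height i := by
  have h := T.height_pos i
  have := T.inner_vsub_vsub_altitudeFoot_eq_height_sq hj.symm
  rw [vsub_eq_sub, vsub_eq_sub, ← neg_sub (T.points j), ← neg_sub (T.altitudeFoot i), inner_neg_neg,
    real_inner_comm] at this
  rw [normal, inner_smul_left, this]
  simp; field_simp

/-- All edges from `P_i` to the other vertices have the same component, the height, along the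
normal, and their barycentric weights add up to one minus the `i`-th coordinate. This links
barycentric coordinates with Euclidean distance. -/
lemma inner_normal_sub (x : Sp d) :
    ⟪normal T i, x - T.points i⟫ = T.height i * (1 - (vertexBasis T).coord i x) := by
  have hsum := (vertexBasis T).sum_coord_apply_eq_one x
  have hx := (vertexBasis T).linear_combination_coord_eq_self x
  have e : x - T.points i = ∑ j, (vertexBasis T).coord j x • (T.points j - T.points i) := by
    simp_rw [smul_sub, Finset.sum_sub_distrib, ← Finset.sum_smul, hsum, one_smul]
    conv_lhs => rw [← hx]
    rfl
  rw [e, inner_sum]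
  have : ∀ j, ⟪normal T i, (vertexBasis T).coord j x • (T.points j - T.points i)⟫
      = (vertexBasis T).coord j x * T.height i
        - if j = i then (vertexBasis T).coord j x * T.height i else 0 := by
    intro j
    rw [inner_smul_right]
    split_ifs with h
    · simp [h]
    · rw [inner_normal_vertex T i h, sub_zero]
  simp_rw [this, Finset.sum_sub_distrib, ← Finset.sum_mul, hsum]
  simp; ring

lemma inner_normal_of_mem_face {x : Sp d} (hx : x ∈ face T i) :
    ⟪normal T i, x - T.points i⟫ = T.height i := by
  rw [inner_normal_sub, ((mem_face_iff T i x).1 hx).2, sub_zero, mul_one]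

lemma coord_eq_one_sub (x : Sp d) :
    (vertexBasis T).coord i x = 1 - ⟪normal T i, x - T.points i⟫ / T.height i := by
  have h := T.height_pos i
  rw [inner_normal_sub]; field_simp; ring

/-- A simplex is the cone with apex a vertex over the opposite face. -/
lemma cone_mem_cell_iff {Y : Sp d} (hY : ⟪normal T i, Y - T.points i⟫ = T.height i) {t : ℝ}
    (ht : 0 < t) (ht1 : t ≤ 1) : T.points i + t • (Y - T.points i) ∈ cell T ↔ Y ∈ face T i := by
  have h := T.height_pos i
  have h0 : (vertexBasis T).coord i Y = 0 := by
    rw [coord_eq_one_sub, hY, div_self h.ne', sub_self]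
  have hc : ∀ j, (vertexBasis T).coord j (T.points i + t • (Y - T.points i))
      = (1 - t) * (if j = i then 1 else 0) + t * (vertexBasis T).coord j Y := by
    intro j
    rw [coord_combo, ← vertexBasis_apply, (vertexBasis T).coord_apply]
  rw [mem_face_iff, mem_cell_iff, mem_cell_iff]
  refine ⟨fun H => ⟨fun j => ?_, h0⟩, fun H j => ?_⟩
  · rcases eq_or_ne j i with rfl | hj
    · exact h0.ge
    · have := H j
      rw [hc, if_neg hj, mul_zero, zero_add] at this
      exact nonneg_of_mul_nonneg_right this ht
  · rw [hc]
    have := H.1 j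
    have h1 : 0 ≤ 1 - t := by linarith
    split_ifs <;> positivity

end normals

/-! ### Integration over a simplex as a cone over a face -/

/-- The orthogonal splitting into the line of `n` and its complement is an isometry from the `ℓ²`
product, on which Lebesgue measure is the product measure. It allows a simplex to be sliced parallel
to a face. -/
lemma exists_normal_coordinates {m : ℕ} (n : Sp (m + 1)) (hn : ‖n‖ = 1) :
    ∃ ι : Sp m →ₗᵢ[ℝ] Sp (m + 1), (∀ z, ⟪n, ι z⟫ = 0) ∧ (∀ x, ⟪n, x⟫ = 0 → ∃ z, ι z = x) ∧
      MeasurePreserving (fun p : ℝ × Sp m => p.1 • n + ι p.2) ∧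
      MeasurableEmbedding (fun p : ℝ × Sp m => p.1 • n + ι p.2) := by
  have : Fact (Module.finrank ℝ (Sp (m + 1)) = m + 1) := ⟨by simp⟩
  have hn0 : n ≠ 0 := by rintro rfl; simp at hn
  let b := OrthonormalBasis.fromOrthogonalSpanSingleton (𝕜 := ℝ) m hn0
  let ι : Sp m →ₗᵢ[ℝ] Sp (m + 1) := (ℝ ∙ n)ᗮ.subtypeₗᵢ.comp b.repr.symm.toLinearIsometry
  have hι : ∀ z, ⟪n, ι z⟫ = 0 := fun z =>
    Submodule.mem_orthogonal_singleton_iff_inner_right.1 (b.repr.symm z).2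
  have hnorm : ∀ p : ℝ × Sp m, ‖p.1 • n + ι p.2‖ = ‖WithLp.toLp 2 p‖ := by
    intro p
    have h1 : ‖p.1 • n + ι p.2‖ ^ 2 = p.1 ^ 2 + ‖p.2‖ ^ 2 := by
      rw [norm_add_sq_real, inner_smul_left, hι, norm_smul, hn, ι.norm_map]; simp
    have h2 : ‖WithLp.toLp 2 p‖ ^ 2 = p.1 ^ 2 + ‖p.2‖ ^ 2 := by
      rw [WithLp.prod_norm_sq_eq_of_L2]; simp
    rw [← sq_eq_sq₀ (norm_nonneg _) (norm_nonneg _), h1, h2]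
  let L : WithLp 2 (ℝ × Sp m) →ₗᵢ[ℝ] Sp (m + 1) :=
    { toFun := fun p => p.fst • n + ι p.snd
      map_add' := fun p q => by simp [add_smul]; abel
      map_smul' := fun c p => by simp [mul_smul]
      norm_map' := fun p => hnorm p.ofLp }
  have hfin : Module.finrank ℝ (WithLp 2 (ℝ × Sp m)) = Module.finrank ℝ (Sp (m + 1)) := by
    rw [(WithLp.linearEquiv 2 ℝ (ℝ × Sp m)).finrank_eq]
    simp [add_comm]
  let E := L.toLinearIsometryEquiv hfin
  have hE : (fun p : ℝ × Sp m => p.1 • n + ι p.2) = E ∘ (WithLp.toLp 2) := rfl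
  have hmp : MeasurePreserving (fun p : ℝ × Sp m => p.1 • n + ι p.2) := by
    rw [hE]
    exact E.measurePreserving.comp (WithLp.volume_preserving_toLp ℝ (Sp m))
  refine ⟨ι, hι, fun x hx => ?_, hmp, ?_⟩
  · refine ⟨b.repr ⟨x, Submodule.mem_orthogonal_singleton_iff_inner_right.2 hx⟩, ?_⟩
    simp [ι]
  · have : Continuous (fun p : ℝ × Sp m => p.1 • n + ι p.2) := by fun_prop
    refine this.measurableEmbedding ?_
    rw [hE]
    exact E.injective.comp (WithLp.toLp_injective 2)

/-- Isometric coordinates on the hyperplane of a face push Lebesgue measure forward to the surface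
measure. -/
lemma map_restrict_eq_faceMeasure {m : ℕ} (T : Simp (m + 1)) (i : Fin (m + 1 + 1))
    {κ : Sp m → Sp (m + 1)} (hκ : Isometry κ) (hr : face T i ⊆ Set.range κ) :
    (volume.restrict (κ ⁻¹' face T i)).map κ = faceMeasure T i := by
  rw [← Measure.restrict_map hκ.continuous.measurable (isCompact_face T i).measurableSet,
    ← EuclideanSpace.euclideanHausdorffMeasure_eq_volume, hκ.map_euclideanHausdorffMeasure,
    Measure.restrict_restrict (isCompact_face T i).measurableSet, Set.inter_eq_left.2 hr]
  rfl

lemma isometry_faceCoordinates {m : ℕ} (T : Simp (m + 1)) (i : Fin (m + 1 + 1))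
    {ι : Sp m →ₗᵢ[ℝ] Sp (m + 1)} (hι : ∀ x, ⟪normal T i, x⟫ = 0 → ∃ z, ι z = x) :
    Isometry (fun z => T.points i + (T.height i • normal T i + ι z)) ∧
      face T i ⊆ Set.range (fun z => T.points i + (T.height i • normal T i + ι z)) := by
  refine ⟨Isometry.of_dist_eq fun a b => by simp, fun x hx => ?_⟩
  obtain ⟨z, hz⟩ := hι (x - T.points i - T.height i • normal T i) (by
    rw [inner_sub_right, inner_smul_right, real_inner_self_eq_norm_sq, norm_normal,
      inner_normal_of_mem_face T i hx]
    ring)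
  exact ⟨z, by simp [hz]⟩

/-- The slice at distance `h t` from the vertex is the face shrunk by the factor `t` about that
vertex, whence the weight `t ^ m`. Fubini in normal coordinates and the substitution `s = h t`,
whose Jacobian is the height, give the formula. -/
theorem setIntegral_cell_eq {m : ℕ} (T : Simp (m + 1)) (i : Fin (m + 1 + 1))
    {f : Sp (m + 1) → ℝ} (hf : Continuous f) :
    ∫ x in cell T, f x = T.height i * ∫ x, (∫ t in (0 : ℝ)..1,
      t ^ m * f (T.points i + t • (x - T.points i))) ∂(faceMeasure T i) := by
  set P := T.points i with hP
  set n := normal T i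
  set h := T.height i
  have hn : ‖n‖ = 1 := norm_normal T i
  have hh : 0 < h := T.height_pos i
  obtain ⟨ι, hι, hιs, hmp, hme⟩ := exists_normal_coordinates n hn
  have hnn : ⟪n, n⟫ = 1 := by rw [real_inner_self_eq_norm_sq, hn]; norm_num
  set Φ : ℝ × Sp m → Sp (m + 1) := fun p => P + (p.1 • n + ι p.2) with hΦ
  have hΦc : Continuous Φ := by fun_prop
  have hΦmp : MeasurePreserving Φ := (measurePreserving_add_left volume P).comp hmp
  have hΦme : MeasurableEmbedding Φ := (measurableEmbedding_addLeft P).comp hme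
  have hΦn : ∀ p, ⟪n, Φ p - P⟫ = p.1 := by
    intro p; simp [hΦ, inner_add_right, inner_smul_right, hι, hn]
  set κ : Sp m → Sp (m + 1) := fun z => Φ (h, z) with hκ_def
  obtain ⟨hκ, hr⟩ : Isometry κ ∧ face T i ⊆ Set.range κ := isometry_faceCoordinates T i hιs
  have hF : IsCompact (κ ⁻¹' face T i) :=
    hκ.isClosedEmbedding.isCompact_preimage (isCompact_face T i)
  set S : Set (ℝ × Sp m) := Φ ⁻¹' cell T with hS
  have hSm : MeasurableSet S := hΦc.measurable (isCompact_cell T).measurableSet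
  have hcone : ∀ t : ℝ, 0 < t → t ≤ 1 → ∀ z, Φ (h * t, t • z) = P + t • (κ z - P) := by
    intro t _ _ z
    simp only [hκ_def, hΦ, map_smul, add_sub_cancel_left, smul_add, smul_smul, mul_comm h t]
  have hcone_mem : ∀ t : ℝ, 0 < t → t ≤ 1 → ∀ z, (h * t, t • z) ∈ S ↔ z ∈ κ ⁻¹' face T i := by
    intro t ht ht1 z
    rw [hS, Set.mem_preimage, hcone t ht ht1, cone_mem_cell_iff T i (hΦn (h, z)) ht ht1]; rfl
  have e1 : ∫ x in cell T, f x = ∫ p, S.indicator (fun p => f (Φ p)) p := by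
    rw [← hΦmp.setIntegral_preimage_emb hΦme, integral_indicator hSm]
  have hint : Integrable (S.indicator (fun p => f (Φ p))) (volume.prod volume) := by
    rw [integrable_indicator_iff hSm]
    exact (hΦmp.integrableOn_comp_preimage hΦme).2
      (hf.continuousOn.integrableOn_compact (isCompact_cell T))
  rw [e1, Measure.volume_eq_prod, integral_prod _ hint]
  -- The height `s = 0` is excluded: its slice is the vertex alone, which is not a null set when `m
  -- = 0`. A single value of `s` does not affect the outer integral.
  have e2 : ∀ s, s ∉ Set.Ioc 0 h → s ≠ 0 → ∫ z, S.indicator (fun p => f (Φ p)) (s, z) = 0 := by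
    intro s hs hs0
    have : ∀ z, (s, z) ∉ S := by
      intro z hz
      have hz' : Φ (s, z) ∈ cell T := hz
      rw [mem_cell_iff] at hz'
      have h1 := hz' i
      have h2 := (vertexBasis T).sum_coord_apply_eq_one (Φ (s, z))
      have h3 : (vertexBasis T).coord i (Φ (s, z)) ≤ 1 := by
        rw [← h2]; exact Finset.single_le_sum (fun j _ => hz' j) (Finset.mem_univ i)
      have h4 := inner_normal_sub T i (Φ (s, z))
      rw [hΦn] at h4
      simp only at h4
      apply hs
      have h5 : 0 ≤ s := by rw [h4]; exact mul_nonneg hh.le (by linarith)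
      refine ⟨lt_of_le_of_ne h5 hs0.symm, ?_⟩
      rw [h4]; nlinarith
    simp [Set.indicator_of_notMem (this _)]
  have e3 : ∫ s, ∫ z, S.indicator (fun p => f (Φ p)) (s, z)
      = ∫ s in (0 : ℝ)..h, ∫ z, S.indicator (fun p => f (Φ p)) (s, z) := by
    rw [intervalIntegral.integral_of_le hh.le, ← integral_indicator measurableSet_Ioc]
    refine integral_congr_ae ?_
    filter_upwards [Measure.ae_ne volume (0 : ℝ)] with s hs
    by_cases h' : s ∈ Set.Ioc 0 h
    · rw [Set.indicator_of_mem h']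
    · rw [Set.indicator_of_notMem h', e2 s h' hs]
  have e4 : ∀ t ∈ Set.Ioc (0 : ℝ) 1, ∫ z, S.indicator (fun p => f (Φ p)) (h * t, z)
      = ∫ z in κ ⁻¹' face T i, t ^ m * f (P + t • (κ z - P)) := by
    intro t ht
    have := Measure.integral_comp_smul (μ := (volume : Measure (Sp m)))
      (fun z => S.indicator (fun p => f (Φ p)) (h * t, z)) t
    simp only [finrank_euclideanSpace, Fintype.card_fin] at this
    rw [abs_of_pos (by have := ht.1; positivity), smul_eq_mul, eq_inv_mul_iff_mul_eq₀
      (by have := ht.1; positivity)] at this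
    rw [← this, integral_const_mul, ← integral_indicator hF.measurableSet]
    congr 2
    funext z
    by_cases hz : z ∈ κ ⁻¹' face T i
    · rw [Set.indicator_of_mem hz, Set.indicator_of_mem ((hcone_mem t ht.1 ht.2 z).2 hz),
        hcone t ht.1 ht.2]
    · rw [Set.indicator_of_notMem hz,
        Set.indicator_of_notMem (fun hc => hz ((hcone_mem t ht.1 ht.2 z).1 hc))]
  have e5 : ∫ s in (0 : ℝ)..h, ∫ z, S.indicator (fun p => f (Φ p)) (s, z)
      = h * ∫ t in (0 : ℝ)..1, ∫ z, S.indicator (fun p => f (Φ p)) (h * t, z) := by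
    have := intervalIntegral.smul_integral_comp_mul_left (a := 0) (b := 1)
      (fun s => ∫ z, S.indicator (fun p => f (Φ p)) (s, z)) h
    rw [mul_zero, mul_one] at this
    rw [← this, smul_eq_mul]
  rw [e3, e5]
  congr 1
  rw [intervalIntegral.integral_of_le zero_le_one, setIntegral_congr_fun measurableSet_Ioc e4,
    integral_integral_swap]
  · rw [← map_restrict_eq_faceMeasure T i hκ hr,
      hκ.isClosedEmbedding.measurableEmbedding.integral_map]
    refine integral_congr_ae (ae_of_all _ fun z => ?_)
    simp only
    rw [intervalIntegral.integral_of_le zero_le_one]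
  · rw [Measure.prod_restrict]
    have hc : Continuous (Function.uncurry fun (t : ℝ) (z : Sp m) =>
        t ^ m * f (P + t • (κ z - P))) := by
      have := hκ.continuous
      unfold Function.uncurry
      fun_prop
    exact (hc.continuousOn.integrableOn_compact ((isCompact_Icc (a := (0 : ℝ)) (b := 1)).prod hF)).mono_set
      (Set.prod_mono Set.Ioc_subset_Icc_self subset_rfl)

lemma faceMeasure_lt_top {m : ℕ} (T : Simp (m + 1)) (i : Fin (m + 1 + 1)) :
    faceMeasure T i Set.univ < ⊤ := by
  obtain ⟨ι, -, hιs, -, -⟩ := exists_normal_coordinates (normal T i) (norm_normal T i)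
  obtain ⟨hκ, hr⟩ := isometry_faceCoordinates T i hιs
  rw [← map_restrict_eq_faceMeasure T i hκ hr,
    Measure.map_apply hκ.continuous.measurable MeasurableSet.univ, Set.preimage_univ,
    Measure.restrict_apply_univ]
  exact (hκ.isClosedEmbedding.isCompact_preimage (isCompact_face T i)).measure_lt_top

instance {m : ℕ} (T : Simp (m + 1)) (i : Fin (m + 1 + 1)) : IsFiniteMeasure (faceMeasure T i) :=
  ⟨faceMeasure_lt_top T i⟩

/-- The divergence theorem for a smooth function times the field `x - P`, with `P` a vertex. -/
theorem setIntegral_cell_green {m : ℕ} (T : Simp (m + 1)) (i : Fin (m + 1 + 1))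
    {u : Sp (m + 1) → ℝ} (hu : ContDiff ℝ 1 u) :
    ∫ x in cell T, (⟪x - T.points i, gradient u x⟫ + (m + 1) * u x)
      = T.height i * ∫ x, u x ∂(faceMeasure T i) := by
  have hg : Continuous (gradient u) :=
    (InnerProductSpace.toDual ℝ _).symm.continuous.comp (hu.continuous_fderiv one_ne_zero)
  have huc := hu.continuous
  rw [setIntegral_cell_eq T i (by fun_prop)]
  congr 2
  funext x
  set P := T.points i
  -- The integrand along a ray is the derivative of `t ^ (m + 1) * u`, so the ray contributes the
  -- value of `u` at its end on the face; the contribution of `t = 0` vanishes because the exponent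
  -- is positive.
  have hd : ∀ t : ℝ, HasDerivAt (fun t : ℝ => t ^ (m + 1) * u (P + t • (x - P)))
      (t ^ m * (⟪P + t • (x - P) - P, gradient u (P + t • (x - P))⟫
        + (m + 1) * u (P + t • (x - P)))) t := by
    intro t
    have h1 : HasDerivAt (fun t : ℝ => P + t • (x - P)) (x - P) t := by
      simpa using! ((hasDerivAt_id t).smul_const (x - P)).const_add P
    have h2 := ((hu.differentiable one_ne_zero) (P + t • (x - P))).hasGradientAt.hasFDerivAt.comp_hasDerivAt t h1
    have h3 := (hasDerivAt_pow (m + 1) t).mul h2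
    convert! h3 using 1
    simp only [InnerProductSpace.toDual_apply_apply, add_sub_cancel_left, inner_smul_left,
      real_inner_comm (x - P), RCLike.conj_to_real, Function.comp_apply]
    simp only [Nat.add_sub_cancel, Nat.cast_add, Nat.cast_one, pow_succ]
    ring
  rw [intervalIntegral.integral_eq_sub_of_hasDerivAt (fun t _ => hd t)]
  · simp
  · exact Continuous.intervalIntegrable (by fun_prop) _ _

/-! ### Mollification in `L²` -/

section mollify

variable {d : ℕ} {E : Type*} [NormedAddCommGroup E] [NormedSpace ℝ E]

lemma eLpNorm_two_sq {α F : Type*} [MeasurableSpace α] [NormedAddCommGroup F] (μ : Measure α)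
    (f : α → F) : eLpNorm f 2 μ ^ 2 = ∫⁻ x, ‖f x‖ₑ ^ 2 ∂μ := by
  have := eLpNorm_nnreal_pow_eq_lintegral (μ := μ) (f := f) (p := 2) two_ne_zero
  simpa using this

/-- Convolution with a normalised bump function. -/
def mollify (ρ : ContDiffBump (0 : Sp d)) (F : Sp d → E) : Sp d → E :=
  ρ.normed volume ⋆[ContinuousLinearMap.lsmul ℝ ℝ, volume] F

lemma mollify_apply (ρ : ContDiffBump (0 : Sp d)) (F : Sp d → E) (x : Sp d) :
    mollify ρ F x = ∫ t, ρ.normed volume t • F (x - t) := rfl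

lemma contDiff_mollify (ρ : ContDiffBump (0 : Sp d)) {F : Sp d → E} (hF : LocallyIntegrable F) :
    ContDiff ℝ ∞ (mollify ρ F) :=
  ρ.hasCompactSupport_normed.contDiff_convolution_left _ ρ.contDiff_normed hF

lemma mollify_sub (ρ : ContDiffBump (0 : Sp d)) {F G : Sp d → E} (hF : LocallyIntegrable F)
    (hG : LocallyIntegrable G) : mollify ρ (F - G) = mollify ρ F - mollify ρ G := by
  funext x
  have h : ∀ {H : Sp d → E}, LocallyIntegrable H →
      Integrable fun t => ρ.normed volume t • H (x - t) := fun hH =>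
    ρ.hasCompactSupport_normed.convolutionExists_left (ContinuousLinearMap.lsmul ℝ ℝ)
      ρ.continuous_normed hH x
  simp only [mollify_apply, Pi.sub_apply, smul_sub]
  exact integral_sub (h hF) (h hG)

/-- The kernel is a probability density, so by Jensen's inequality (here the comparison of `L¹` and
`L²` norms) the square of the mollification is at most the mollified square. Tonelli and translation
invariance conclude. -/
lemma eLpNorm_mollify_le (ρ : ContDiffBump (0 : Sp d)) {F : Sp d → E}
    (hF : AEStronglyMeasurable F) : eLpNorm (mollify ρ F) 2 volume ≤ eLpNorm F 2 volume := by
  set k : Sp d → ℝ≥0∞ := fun t => ENNReal.ofReal (ρ.normed volume t) with hk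
  have hkm : Measurable k := ρ.continuous_normed.measurable.ennreal_ofReal
  have hk1 : ∫⁻ t, k t = 1 := by
    rw [hk, ← ofReal_integral_eq_lintegral_ofReal ρ.integrable_normed
      (ae_of_all _ ρ.nonneg_normed), ρ.integral_normed, ENNReal.ofReal_one]
  have : IsProbabilityMeasure (volume.withDensity k) :=
    ⟨by rw [withDensity_apply _ MeasurableSet.univ, Measure.restrict_univ, hk1]⟩
  have hpt : ∀ x, ‖mollify ρ F x‖ₑ ^ 2 ≤ ∫⁻ t, k t * ‖F (x - t)‖ₑ ^ 2 := by
    intro x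
    have hFx : AEStronglyMeasurable (fun t => F (x - t)) :=
      hF.comp_quasiMeasurePreserving
        (quasiMeasurePreserving_sub_left_of_right_invariant volume x)
    have hFν : AEStronglyMeasurable (fun t => F (x - t)) (volume.withDensity k) :=
      hFx.mono_ac (withDensity_absolutelyContinuous _ _)
    have h1 : ‖mollify ρ F x‖ₑ ≤ eLpNorm (fun t => F (x - t)) 1 (volume.withDensity k) := by
      rw [eLpNorm_one_eq_lintegral_enorm, lintegral_withDensity_eq_lintegral_mul₀ hkm.aemeasurable
        hFx.enorm, mollify_apply]
      refine (enorm_integral_le_lintegral_enorm _).trans (le_of_eq (lintegral_congr fun t => ?_))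
      rw [enorm_smul, Pi.mul_apply, Real.enorm_of_nonneg (ρ.nonneg_normed t)]
    have h2 := h1.trans (eLpNorm_le_eLpNorm_of_exponent_le one_le_two hFν)
    calc ‖mollify ρ F x‖ₑ ^ 2 ≤ eLpNorm (fun t => F (x - t)) 2 (volume.withDensity k) ^ 2 := by
          gcongr
      _ = ∫⁻ t, k t * ‖F (x - t)‖ₑ ^ 2 := by
          rw [eLpNorm_two_sq, lintegral_withDensity_eq_lintegral_mul₀ hkm.aemeasurable
            (hFx.enorm.pow_const 2)]
          rfl
  rw [← ENNReal.pow_le_pow_left_iff two_ne_zero, eLpNorm_two_sq, eLpNorm_two_sq]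
  have hm : AEMeasurable (Function.uncurry fun x t : Sp d => k t * ‖F (x - t)‖ₑ ^ 2)
      (volume.prod volume) := by
    refine (hkm.comp measurable_snd).aemeasurable.mul (AEMeasurable.pow_const ?_ 2)
    exact (hF.comp_quasiMeasurePreserving
      (quasiMeasurePreserving_sub_of_right_invariant volume volume)).enorm
  calc ∫⁻ x, ‖mollify ρ F x‖ₑ ^ 2 ≤ ∫⁻ x, ∫⁻ t, k t * ‖F (x - t)‖ₑ ^ 2 := lintegral_mono hpt
    _ = ∫⁻ t, ∫⁻ x, k t * ‖F (x - t)‖ₑ ^ 2 := lintegral_lintegral_swap hm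
    _ = ∫⁻ t, k t * ∫⁻ x, ‖F x‖ₑ ^ 2 := by
        refine lintegral_congr fun t => ?_
        rw [lintegral_const_mul' _ _ ENNReal.ofReal_ne_top,
          lintegral_sub_right_eq_self (fun x => ‖F x‖ₑ ^ 2)]
    _ = ∫⁻ x, ‖F x‖ₑ ^ 2 := by rw [lintegral_mul_const _ hkm, hk1, one_mul]

-- The change of variables costs `s ^ (-d / 2)`. The crude bound `2 ^ d`, uniform over `s ≥ 1/2`, is
-- enough for letting `s` tend to `1`.
omit [NormedSpace ℝ E] in
lemma eLpNorm_comp_dilation_le (c : Sp d) {s : ℝ} (hs : 1 / 2 ≤ s) {H : Sp d → E}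
    (hH : AEStronglyMeasurable H) :
    eLpNorm (fun x => H (c + s • (x - c))) 2 volume ≤ 2 ^ d * eLpNorm H 2 volume := by
  have hs0 : 0 < s := by linarith
  have hmap : Measure.map (fun x : Sp d => c + s • (x - c)) volume
      = ENNReal.ofReal |(s ^ d)⁻¹| • volume := by
    have h1 : (fun x : Sp d => c + s • (x - c)) = (fun x => (c - s • c) + x) ∘ (fun x => s • x) := by
      funext x; simp [smul_sub]; abel
    rw [h1, ← Measure.map_map (measurable_const_add _) (measurable_const_smul _),
      Measure.map_addHaar_smul _ hs0.ne', Measure.map_smul, map_add_left_eq_self]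
    simp
  have hH' : AEStronglyMeasurable H (Measure.map (fun x : Sp d => c + s • (x - c)) volume) := by
    rw [hmap]; exact hH.smul_measure _
  have h2 := eLpNorm_map_measure (p := 2) hH' (by fun_prop)
  rw [hmap, eLpNorm_smul_measure_of_ne_top (by simp)] at h2
  change _ = eLpNorm (fun x => H (c + s • (x - c))) 2 volume at h2
  rw [← h2, smul_eq_mul]
  gcongr
  have h3 : ENNReal.ofReal |(s ^ d)⁻¹| ≤ 2 ^ d := by
    rw [abs_of_pos (by positivity), ← inv_pow, ENNReal.ofReal_pow (by positivity)]
    gcongr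
    rw [ENNReal.ofReal_le_iff_le_toReal (by simp)]
    simpa using inv_anti₀ (by norm_num) hs
  calc ENNReal.ofReal |(s ^ d)⁻¹| ^ (1 / (2 : ℝ≥0∞)).toReal
      ≤ (2 ^ d) ^ (1 / (2 : ℝ≥0∞)).toReal := by gcongr
    _ ≤ (2 ^ d) ^ (1 : ℝ) :=
        ENNReal.rpow_le_rpow_of_exponent_le (one_le_pow₀ one_le_two) (by simp; norm_num)
    _ = 2 ^ d := ENNReal.rpow_one _

/-- Mollification followed by a dilation with centre `c` is close to the identity in `L²`. -/
lemma exists_eLpNorm_mollify_dilation_sub_le [CompleteSpace E] {F : Sp d → E} (hF : MemLp F 2 volume) (c : Sp d)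
    {B : Set (Sp d)} (hB : Bornology.IsBounded B) (hBm : MeasurableSet B) {η : ℝ≥0∞} (hη : η ≠ 0) :
    ∃ δ > 0, ∀ s : ℝ, 1 / 2 ≤ s → s ≤ 1 → 1 - s < δ → ∀ ρ : ContDiffBump (0 : Sp d), ρ.rOut < δ →
      eLpNorm (fun x => mollify ρ F (c + s • (x - c)) - F x) 2 (volume.restrict B) ≤ η := by
  obtain ⟨R, hR⟩ := hB.subset_closedBall c
  have hV : volume B ≠ ⊤ := hB.measure_lt_top.ne
  -- With `g` continuous of compact support and within `a` of `F`, the mollified and dilated `F - g`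
  -- costs `2 ^ d * a`, the term `F - g` itself costs `a`, and `η / 2` is left for the error of `g`.
  set a : ℝ≥0∞ := η / 2 / (2 ^ d + 1) with ha
  have hC : (2 ^ d + 1 : ℝ≥0∞) ≠ ⊤ := by finiteness
  have ha0 : a ≠ 0 := ENNReal.div_ne_zero.2 ⟨ENNReal.div_ne_zero.2 ⟨hη, by simp⟩, hC⟩
  have haC : (2 ^ d + 1) * a ≤ η / 2 := ENNReal.mul_div_le
  obtain ⟨g, hgs, hFg, hgc, hgL⟩ := hF.exists_hasCompactSupport_eLpNorm_sub_le (by simp) ha0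
  obtain ⟨κ, hκ, hκV⟩ := ENNReal.exists_nnreal_pos_mul_lt
    (a := (volume B) ^ (2 : ℝ≥0∞).toReal⁻¹) (b := η / 2) (by finiteness)
    (ENNReal.div_ne_zero.2 ⟨hη, by simp⟩)
  obtain ⟨δ, hδ, hg⟩ := Metric.uniformContinuous_iff.1
    (hgs.uniformContinuous_of_continuous hgc) (κ / 2) (by positivity)
  -- The dilation moves a point `x` of `B` by `(1 - s) * ‖x - c‖ ≤ (1 - s) * |R|`, which the second
  -- bound keeps below `δ`.
  refine ⟨min δ (δ / (|R| + 1)), by positivity, fun s hs hs1 hsδ ρ hρ => ?_⟩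
  have hFl := hF.locallyIntegrable one_le_two
  have hgl := hgL.locallyIntegrable one_le_two
  have hsub : AEStronglyMeasurable (mollify ρ (F - g)) :=
    (contDiff_mollify ρ (hFl.sub hgl)).continuous.aestronglyMeasurable
  have hmg : Continuous (mollify ρ g) := (contDiff_mollify ρ hgl).continuous
  have hdec : (fun x => mollify ρ F (c + s • (x - c)) - F x)
      = (fun x => mollify ρ (F - g) (c + s • (x - c)))
        + ((fun x => mollify ρ g (c + s • (x - c)) - g x) - (F - g)) := by
    funext x
    simp only [mollify_sub ρ hFl hgl, Pi.add_apply, Pi.sub_apply]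
    abel
  have h1 : eLpNorm (fun x => mollify ρ (F - g) (c + s • (x - c))) 2 (volume.restrict B)
      ≤ 2 ^ d * a := by
    refine (eLpNorm_mono_measure _ Measure.restrict_le_self).trans ?_
    refine (eLpNorm_comp_dilation_le c hs hsub).trans ?_
    gcongr
    exact (eLpNorm_mollify_le ρ (hF.sub hgL).1).trans hFg
  have h2 : eLpNorm (fun x => mollify ρ g (c + s • (x - c)) - g x) 2 (volume.restrict B)
      ≤ η / 2 := by
    refine le_trans ?_ hκV.le
    refine (eLpNorm_le_of_ae_bound (C := κ) ?_).trans (le_of_eq ?_)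
    · filter_upwards [ae_restrict_mem hBm] with x hx
      have hx1 : dist (c + s • (x - c)) x < δ := by
        have e : c + s • (x - c) - x = (s - 1) • (x - c) := by
          rw [sub_smul, one_smul]; abel
        have hxR : ‖x - c‖ ≤ |R| := (mem_closedBall_iff_norm.1 (hR hx)).trans (le_abs_self R)
        rw [dist_eq_norm, e, norm_smul, Real.norm_eq_abs, abs_sub_comm, abs_of_nonneg (by linarith)]
        have h3 : 1 - s < δ / (|R| + 1) := hsδ.trans_le (min_le_right _ _)
        rw [lt_div_iff₀ (by positivity)] at h3
        nlinarith [norm_nonneg (x - c)]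
      have h3 := ρ.dist_normed_convolution_le (μ := volume) (g := g) (x₀ := c + s • (x - c))
        (ε := κ / 2) hgc.aestronglyMeasurable
        fun y hy => (hg ((Metric.mem_ball.1 hy).trans (hρ.trans_le (min_le_left _ _)))).le
      have h4 := hg hx1
      rw [← dist_eq_norm]
      calc dist (mollify ρ g (c + s • (x - c))) (g x) ≤ κ / 2 + κ / 2 :=
            (dist_triangle _ (g (c + s • (x - c))) _).trans (add_le_add h3 h4.le)
        _ = κ := add_halves _
    · rw [Measure.restrict_apply_univ, mul_comm, ENNReal.ofReal_coe_nnreal]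
  have h3 : eLpNorm (F - g) 2 (volume.restrict B) ≤ a :=
    (eLpNorm_mono_measure _ Measure.restrict_le_self).trans hFg
  rw [hdec]
  refine (eLpNorm_add_le ?_ ?_ one_le_two).trans ?_
  · exact ((contDiff_mollify ρ (hFl.sub hgl)).continuous.comp
      (by fun_prop)).aestronglyMeasurable
  · exact ((hmg.comp (by fun_prop)).sub hgc).aestronglyMeasurable.sub (hF.sub hgL).1.restrict
  calc _ ≤ 2 ^ d * a + (η / 2 + a) := by
        gcongr
        refine (eLpNorm_sub_le ?_ (hF.sub hgL).1.restrict one_le_two).trans (add_le_add h2 h3)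
        exact ((hmg.comp (by fun_prop)).sub hgc).aestronglyMeasurable
    _ = (2 ^ d + 1) * a + η / 2 := by ring
    _ ≤ η / 2 + η / 2 := by gcongr
    _ = η := ENNReal.add_halves η

end mollify

/-! ### Density of smooth functions in `H¹` of a star-shaped set -/

section density

variable {d : ℕ}

lemma gradient_bump_comp {ρ : ContDiffBump (0 : Sp d)} (y z : Sp d) :
    gradient (fun z => ρ.normed volume (y - z)) z = -gradient (ρ.normed volume) (y - z) := by
  have h1 : HasFDerivAt (ρ.normed volume) (fderiv ℝ (ρ.normed volume) (y - z)) (y - z) :=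
    ((ρ.contDiff_normed (n := 1)).differentiable one_ne_zero _).hasFDerivAt
  have h2 := h1.comp z ((hasFDerivAt_id z).const_sub y)
  rw [gradient, gradient, ← map_neg]
  congr 1
  refine Eq.trans h2.fderiv ?_
  ext v; simp

/-- Away from the boundary, mollification commutes with the weak gradient. -/
lemma gradient_mollify {U : Set (Sp d)} (hU : IsOpen U) {f : Sp d → ℝ} {g : Sp d → Sp d}
    (hf : MemLp f 2 (volume.restrict U)) (hfg : HasWeakGrad U f g) (ρ : ContDiffBump (0 : Sp d))
    {y : Sp d} (hy : Metric.closedBall y ρ.rOut ⊆ U) :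
    gradient (mollify ρ (U.indicator f)) y = mollify ρ (U.indicator g) y := by
  have hF : LocallyIntegrable (U.indicator f) :=
    ((memLp_indicator_iff_restrict hU.measurableSet).2 hf).locallyIntegrable one_le_two
  have h1 := (ρ.hasCompactSupport_normed (μ := volume)).hasFDerivAt_convolution_left (μ := volume)
    (ContinuousLinearMap.lsmul ℝ ℝ) ρ.contDiff_normed hF y
  -- The reflected and translated kernel is supported in the closed ball about `y`, so it is
  -- admissible in the definition of the weak gradient; testing with it is differentiating the
  -- convolution under the integral.
  have htest : IsTest U (fun z => ρ.normed volume (y - z)) := by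
    have hts : tsupport (fun z => ρ.normed volume (y - z)) ⊆ Metric.closedBall y ρ.rOut := by
      refine closure_minimal (fun z hz => ?_) Metric.isClosed_closedBall
      have : y - z ∈ Function.support (ρ.normed volume) := hz
      rw [ρ.support_normed_eq (μ := volume), mem_ball_zero_iff] at this
      rw [Metric.mem_closedBall, dist_comm, dist_eq_norm]
      exact this.le
    refine ⟨(ρ.contDiff_normed (μ := volume)).comp (by fun_prop), ?_, hts.trans hy⟩
    exact (isCompact_closedBall y ρ.rOut).of_isClosed_subset (isClosed_tsupport _) hts
  have h2 := hfg _ htest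
  have h3 : gradient (mollify ρ (U.indicator f)) y
      = ∫ z, U.indicator f z • gradient (ρ.normed volume) (y - z) := by
    refine (HasGradientAt.gradient (f' := ∫ z, U.indicator f z • gradient (ρ.normed volume) (y - z)) ?_)
    rw [hasGradientAt_iff_hasFDerivAt]
    convert! h1 using 1
    rw [convolution_eq_swap]
    refine ((InnerProductSpace.toDual ℝ (Sp d)).toContinuousLinearEquiv.integral_comp_comm _).symm.trans ?_
    refine integral_congr_ae (ae_of_all _ fun z => ?_)
    ext v
    simp [gradient, ContinuousLinearMap.precompL_apply, mul_comm]
  have e1 : ∫ z, U.indicator f z • gradient (ρ.normed volume) (y - z)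
      = -∫ z in U, f z • gradient (fun z => ρ.normed volume (y - z)) z := by
    rw [← integral_neg, ← integral_indicator hU.measurableSet]
    refine integral_congr_ae (ae_of_all _ fun z => ?_)
    by_cases hz : z ∈ U <;> simp [hz, gradient_bump_comp]
  rw [h3, e1, h2, neg_neg, ← integral_indicator hU.measurableSet, mollify]
  rw [convolution_eq_swap]
  refine integral_congr_ae (ae_of_all _ fun z => ?_)
  by_cases hz : z ∈ U <;> simp [hz]

lemma gradient_comp_dilation {v : Sp d → ℝ} (hv : Differentiable ℝ v) (c : Sp d) (s : ℝ)
    (x : Sp d) :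
    gradient (fun x => v (c + s • (x - c))) x = s • gradient v (c + s • (x - c)) := by
  have h1 := (hv (c + s • (x - c))).hasFDerivAt.comp x
    ((((hasFDerivAt_id x).sub_const c).const_smul s).const_add c)
  rw [gradient, gradient, ← map_smul]
  congr 1
  refine Eq.trans h1.fderiv ?_
  ext v; simp

/-- Smooth functions are dense in `H¹` of the interior of a compact star-shaped set. -/
theorem exists_contDiff_eLpNorm_sub_le {K : Set (Sp d)} (hK : IsCompact K) {c : Sp d}
    (hc : ∀ x ∈ K, ∀ s : ℝ, 0 ≤ s → s < 1 → c + s • (x - c) ∈ interior K)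
    {f : Sp d → ℝ} {g : Sp d → Sp d} (hf : MemLp f 2 (volume.restrict (interior K)))
    (hg : MemLp g 2 (volume.restrict (interior K))) (hfg : HasWeakGrad (interior K) f g)
    {η : ℝ≥0∞} (hη : η ≠ 0) :
    ∃ u : Sp d → ℝ, ContDiff ℝ ∞ u ∧ eLpNorm (u - f) 2 (volume.restrict (interior K)) ≤ η ∧
      eLpNorm (gradient u - g) 2 (volume.restrict (interior K)) ≤ η := by
  set U := interior K with hUdef
  have hU : IsOpen U := isOpen_interior
  have hUb : Bornology.IsBounded U := hK.isBounded.subset interior_subset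
  set F := U.indicator f with hFdef
  set G := U.indicator g with hGdef
  have hF : MemLp F 2 volume := (memLp_indicator_iff_restrict hU.measurableSet).2 hf
  have hG : MemLp G 2 volume := (memLp_indicator_iff_restrict hU.measurableSet).2 hg
  have hη2 : η / 2 ≠ 0 := ENNReal.div_ne_zero.2 ⟨hη, by simp⟩
  obtain ⟨δ₁, hδ₁, h1⟩ := exists_eLpNorm_mollify_dilation_sub_le hF c hUb hU.measurableSet hη
  obtain ⟨δ₂, hδ₂, h2⟩ := exists_eLpNorm_mollify_dilation_sub_le hG c hUb hU.measurableSet hη2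
  obtain ⟨κ, hκ, hκG⟩ := ENNReal.exists_nnreal_pos_mul_lt (a := eLpNorm G 2 volume) (b := η / 2)
    hG.2.ne hη2
  -- The bound `1 / 2` keeps `s` in the range of the dilation estimate, the halves make `1 - s < δ`
  -- strict, and `κ` controls the error `τ • G` caused by the factor `s` in the gradient of a
  -- dilated function.
  set τ : ℝ := min (1 / 2) (min (δ₁ / 2) (min (δ₂ / 2) κ)) with hτ
  have hτ0 : 0 < τ := by positivity
  have hτ1 : τ ≤ 1 / 2 := min_le_left _ _
  have hτ2 : τ ≤ δ₁ / 2 := (min_le_right _ _).trans (min_le_left _ _)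
  have hτ3 : τ ≤ δ₂ / 2 := ((min_le_right _ _).trans (min_le_right _ _)).trans (min_le_left _ _)
  have hτ4 : τ ≤ κ := ((min_le_right _ _).trans (min_le_right _ _)).trans (min_le_right _ _)
  set s : ℝ := 1 - τ with hs
  -- The contracted copy of `K` is a compact subset of `U`. For a small mollification radius the
  -- values of the convolution on it depend only on `f` inside `U`, so the jump of the extension by
  -- zero is never seen.
  have hKs : IsCompact ((fun x => c + s • (x - c)) '' K) := hK.image (by fun_prop)
  have hKsU : (fun x => c + s • (x - c)) '' K ⊆ U := by
    rintro _ ⟨x, hx, rfl⟩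
    exact hc x hx s (by linarith) (by linarith)
  obtain ⟨ε, hε, hεU⟩ := hKs.exists_cthickening_subset_open hU hKsU
  set r : ℝ := min ε (min (δ₁ / 2) (δ₂ / 2)) with hr
  have hr0 : 0 < r := by positivity
  let ρ : ContDiffBump (0 : Sp d) := ⟨r / 2, r, by positivity, by linarith⟩
  have hr1 : ρ.rOut < δ₁ := by
    have : r ≤ δ₁ / 2 := (min_le_right _ _).trans (min_le_left _ _)
    change r < δ₁; linarith
  have hr2 : ρ.rOut < δ₂ := by
    have : r ≤ δ₂ / 2 := (min_le_right _ _).trans (min_le_right _ _)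
    change r < δ₂; linarith
  have hball : ∀ x ∈ K, Metric.closedBall (c + s • (x - c)) ρ.rOut ⊆ U := by
    intro x hx
    refine Set.Subset.trans ?_ hεU
    refine (Metric.closedBall_subset_closedBall (min_le_left _ _)).trans ?_
    exact Metric.closedBall_subset_cthickening
      (Set.mem_image_of_mem (fun x => c + s • (x - c)) hx) ε
  have hsm := contDiff_mollify ρ (hF.locallyIntegrable one_le_two)
  have hsmG := contDiff_mollify ρ (hG.locallyIntegrable one_le_two)
  have hmeas : MeasurableSet U := hU.measurableSet
  refine ⟨fun x => mollify ρ F (c + s • (x - c)), hsm.comp (by fun_prop), ?_, ?_⟩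
  · refine le_trans (le_of_eq (eLpNorm_congr_ae ?_))
      (h1 s (by linarith) (by linarith) (by linarith) ρ hr1)
    filter_upwards [ae_restrict_mem hmeas] with x hx
    simp [hFdef, hx]
  · have hgr : ∀ x ∈ U, gradient (fun x => mollify ρ F (c + s • (x - c))) x
        = s • mollify ρ G (c + s • (x - c)) := by
      intro x hx
      rw [gradient_comp_dilation (hsm.differentiable (by simp)),
        gradient_mollify hU hf hfg ρ (hball x (interior_subset hx))]
    have hm1 : AEStronglyMeasurable (fun x => mollify ρ G (c + s • (x - c)) - G x)
        (volume.restrict U) :=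
      ((hsmG.continuous.comp (by fun_prop)).aestronglyMeasurable).sub hG.1.restrict
    calc eLpNorm (gradient (fun x => mollify ρ F (c + s • (x - c))) - g) 2 (volume.restrict U)
        = eLpNorm (s • (fun x => mollify ρ G (c + s • (x - c)) - G x) - τ • G) 2
            (volume.restrict U) := by
          refine eLpNorm_congr_ae ?_
          filter_upwards [ae_restrict_mem hmeas] with x hx
          rw [Pi.sub_apply, hgr x hx]
          simp only [Pi.sub_apply, Pi.smul_apply, hGdef, Set.indicator_of_mem hx]
          rw [hs]; module
      _ ≤ eLpNorm (s • (fun x => mollify ρ G (c + s • (x - c)) - G x)) 2 (volume.restrict U)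
            + eLpNorm (τ • G) 2 (volume.restrict U) :=
          eLpNorm_sub_le (hm1.const_smul _) (hG.1.restrict.const_smul _) one_le_two
      _ ≤ η / 2 + η / 2 := by
          refine add_le_add ?_ ?_
          · rw [eLpNorm_const_smul]
            refine le_trans ?_ (h2 s (by linarith) (by linarith) (by linarith) ρ hr2)
            refine mul_le_of_le_one_left' ?_
            rw [Real.enorm_of_nonneg (by linarith)]
            exact ENNReal.ofReal_le_one.2 (by linarith)
          · rw [eLpNorm_const_smul]
            refine le_trans ?_ hκG.le
            refine mul_le_mul' ?_ (eLpNorm_mono_measure _ Measure.restrict_le_self)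
            rw [Real.enorm_of_nonneg hτ0.le, ← ENNReal.ofReal_coe_nnreal]
            exact ENNReal.ofReal_le_ofReal hτ4
      _ = η := ENNReal.add_halves η

end density

/-! ### Weak gradients -/

section weak

variable {d : ℕ}

lemma weakGrad_spec {U : Set (Sp d)} {f : Sp d → ℝ} (hf : f ∈ H1 U) :
    MemLp (weakGrad U f) 2 (volume.restrict U) ∧ HasWeakGrad U f (weakGrad U f) := by
  rw [weakGrad, dif_pos hf.2]
  exact hf.2.choose_spec

lemma IsTest.mono {U V : Set (Sp d)} (hUV : U ⊆ V) {φ : Sp d → ℝ} (h : IsTest U φ) :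
    IsTest V φ := ⟨h.1, h.2.1, h.2.2.trans hUV⟩

lemma IsTest.eq_zero {U : Set (Sp d)} {φ : Sp d → ℝ} (h : IsTest U φ) {x : Sp d} (hx : x ∉ U) :
    φ x = 0 := image_eq_zero_of_notMem_tsupport fun hx' => hx (h.2.2 hx')

lemma IsTest.gradient_eq_zero {U : Set (Sp d)} {φ : Sp d → ℝ} (h : IsTest U φ) {x : Sp d}
    (hx : x ∉ U) : gradient φ x = 0 := by
  rw [gradient, image_eq_zero_of_notMem_tsupport fun hx' => hx (h.2.2 (tsupport_fderiv_subset ℝ hx')),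
    map_zero]

lemma IsTest.memLp_top {U : Set (Sp d)} {φ : Sp d → ℝ} (h : IsTest U φ)
    (μ : Measure (Sp d)) [IsFiniteMeasureOnCompacts μ] : MemLp φ ⊤ μ :=
  h.1.continuous.memLp_of_hasCompactSupport h.2.1

lemma setIntegral_eq_of_subset {E : Type*} [NormedAddCommGroup E] [NormedSpace ℝ E]
    {U V : Set (Sp d)} (hUV : U ⊆ V) {F : Sp d → E} (hF : ∀ x ∉ U, F x = 0) :
    ∫ x in V, F x = ∫ x in U, F x := by
  rw [setIntegral_eq_integral_of_forall_compl_eq_zero hF,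
    setIntegral_eq_integral_of_forall_compl_eq_zero fun x hx => hF x fun hx' => hx (hUV hx')]

lemma HasWeakGrad.mono {U V : Set (Sp d)} (hUV : U ⊆ V) {f : Sp d → ℝ} {g : Sp d → Sp d}
    (h : HasWeakGrad V f g) : HasWeakGrad U f g := by
  intro φ hφ
  have := h φ (hφ.mono hUV)
  rwa [setIntegral_eq_of_subset hUV fun x hx => by rw [hφ.gradient_eq_zero hx, smul_zero],
    setIntegral_eq_of_subset hUV fun x hx => by rw [hφ.eq_zero hx, zero_smul]] at this

lemma H1_mono {U V : Set (Sp d)} (hUV : U ⊆ V) {f : Sp d → ℝ} (hf : f ∈ H1 V) : f ∈ H1 U := by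
  obtain ⟨h1, g, h2, h3⟩ := hf
  have := Measure.restrict_mono_set (volume : Measure (Sp d)) hUV
  exact ⟨h1.mono_measure this, g, h2.mono_measure this, h3.mono hUV⟩

/-- The fundamental lemma of the calculus of variations, for values in any complete space so as to
cover weak gradients and weak divergences alike. Both `weakGrad` and `weakDiv` are arbitrary
choices, and this identifies them with explicit functions. -/
lemma ae_eq_of_forall_test {E : Type*} [NormedAddCommGroup E] [NormedSpace ℝ E] [CompleteSpace E]
    {U : Set (Sp d)} (hU : IsOpen U) (hUb : Bornology.IsBounded U) {g g' : Sp d → E}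
    (hg : MemLp g 2 (volume.restrict U)) (hg' : MemLp g' 2 (volume.restrict U))
    (h : ∀ φ, IsTest U φ → ∫ x in U, φ x • g x = ∫ x in U, φ x • g' x) :
    g =ᵐ[volume.restrict U] g' := by
  have : IsFiniteMeasure (volume.restrict U) := ⟨by simpa using hUb.measure_lt_top⟩
  have hi := hg.integrable one_le_two
  have hi' := hg'.integrable one_le_two
  rw [Filter.EventuallyEq, ae_restrict_iff' hU.measurableSet]
  have := hU.ae_eq_zero_of_integral_contDiff_smul_eq_zero (μ := volume) (f := g - g')
    (IntegrableOn.locallyIntegrableOn (hi.sub hi')) fun φ h1 h2 h3 => by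
      have hφ : IsTest U φ := ⟨h1, h2, h3⟩
      rw [← setIntegral_eq_integral_of_forall_compl_eq_zero (s := U)
        fun x hx => by rw [hφ.eq_zero hx, zero_smul]]
      simp only [Pi.sub_apply, smul_sub]
      exact (integral_sub (hi.smul_of_top_right (hφ.memLp_top _))
        (hi'.smul_of_top_right (hφ.memLp_top _))).trans (sub_eq_zero.2 (h φ hφ))
  filter_upwards [this] with x hx hxU
  exact sub_eq_zero.1 (hx hxU)

lemma HasWeakGrad.ae_eq {U : Set (Sp d)} (hU : IsOpen U) (hUb : Bornology.IsBounded U)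
    {f : Sp d → ℝ} {g g' : Sp d → Sp d} (hg : MemLp g 2 (volume.restrict U))
    (hg' : MemLp g' 2 (volume.restrict U)) (h : HasWeakGrad U f g) (h' : HasWeakGrad U f g') :
    g =ᵐ[volume.restrict U] g' :=
  ae_eq_of_forall_test hU hUb hg hg' fun φ hφ => neg_injective ((h φ hφ).symm.trans (h' φ hφ))

end weak

/-! ### Traces -/

section trace

variable {m : ℕ} (T : Simp (m + 1)) (i : Fin (m + 1 + 1))

instance isFiniteMeasure_restrict_interior_cell {d : ℕ} (T : Simp d) :
    IsFiniteMeasure (volume.restrict (interior (cell T))) :=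
  ⟨by simpa using (measure_mono interior_subset).trans_lt (volume_cell_lt_top T)⟩

lemma continuous_gradient {d : ℕ} {u : Sp d → ℝ} (hu : ContDiff ℝ 1 u) : Continuous (gradient u) :=
  (InnerProductSpace.toDual ℝ _).symm.continuous.comp (hu.continuous_fderiv one_ne_zero)

lemma gradient_sub' {d : ℕ} {u v : Sp d → ℝ} (hu : Differentiable ℝ u) (hv : Differentiable ℝ v) :
    gradient (u - v) = gradient u - gradient v := by
  funext x
  simp only [gradient, Pi.sub_apply, ← map_sub]
  rw [fderiv_sub (hu x) (hv x)]

lemma gradient_sq {d : ℕ} {u : Sp d → ℝ} (hu : Differentiable ℝ u) (x : Sp d) :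
    gradient (fun x => u x ^ 2) x = (2 * u x) • gradient u x := by
  have h1 := (hu x).hasFDerivAt.pow 2
  rw [gradient, gradient, ← map_smul]
  congr 1
  refine Eq.trans h1.fderiv ?_
  simp

lemma Continuous.memLp_restrict_cell {d : ℕ} {E : Type*} [NormedAddCommGroup E] (T : Simp d)
    {v : Sp d → E} (hv : Continuous v) (p : ℝ≥0∞) :
    MemLp v p (volume.restrict (interior (cell T))) := by
  obtain ⟨C, hC⟩ := (isCompact_cell T).exists_bound_of_continuousOn hv.continuousOn
  refine MemLp.of_bound hv.aestronglyMeasurable C ?_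
  filter_upwards [ae_restrict_mem isOpen_interior.measurableSet] with x hx
  exact hC x (interior_subset hx)

lemma Continuous.memLp_faceMeasure {E : Type*} [NormedAddCommGroup E]
    {v : Sp (m + 1) → E} (hv : Continuous v) (p : ℝ≥0∞) : MemLp v p (faceMeasure T i) := by
  obtain ⟨C, hC⟩ := (isCompact_face T i).exists_bound_of_continuousOn hv.continuousOn
  refine MemLp.of_bound hv.aestronglyMeasurable C ?_
  filter_upwards [ae_restrict_mem (isCompact_face T i).measurableSet] with x hx
  exact hC x hx

lemma setIntegral_interior_cell {d : ℕ} {E : Type*} [NormedAddCommGroup E] [NormedSpace ℝ E]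
    (T : Simp d) (f : Sp d → E) : ∫ x in interior (cell T), f x = ∫ x in cell T, f x :=
  setIntegral_congr_set (interior_cell_ae_eq T)

lemma exists_norm_sub_vertex_le {d : ℕ} (T : Simp d) (i : Fin (d + 1)) :
    ∃ D : ℝ, 0 ≤ D ∧ ∀ᵐ x ∂(volume.restrict (interior (cell T))), ‖x - T.points i‖ ≤ D := by
  obtain ⟨C, hC⟩ := (isCompact_cell T).exists_bound_of_continuousOn (f := fun x => x - T.points i)
    (by fun_prop)
  refine ⟨|C|, abs_nonneg _, ?_⟩
  filter_upwards [ae_restrict_mem isOpen_interior.measurableSet] with x hx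
  exact (hC x (interior_subset hx)).trans (le_abs_self C)

lemma ofReal_integral_norm_sq {α F : Type*} [MeasurableSpace α] [NormedAddCommGroup F]
    {μ : Measure α} {f : α → F} (hf : MemLp f 2 μ) :
    ENNReal.ofReal (∫ x, ‖f x‖ ^ 2 ∂μ) = eLpNorm f 2 μ ^ 2 := by
  rw [eLpNorm_two_sq, ofReal_integral_eq_lintegral_ofReal (hf.integrable_norm_pow two_ne_zero)
    (ae_of_all _ fun x => by positivity)]
  refine lintegral_congr fun x => ?_
  rw [ENNReal.ofReal_pow (norm_nonneg _), ofReal_norm]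

lemma integrableOn_green {f : Sp (m + 1) → ℝ} {g : Sp (m + 1) → Sp (m + 1)}
    (hf : MemLp f 2 (volume.restrict (interior (cell T))))
    (hg : MemLp g 2 (volume.restrict (interior (cell T)))) :
    Integrable (fun x => ⟪x - T.points i, g x⟫) (volume.restrict (interior (cell T))) ∧
    Integrable (fun x => (m + 1 : ℝ) * f x) (volume.restrict (interior (cell T))) := by
  obtain ⟨D, hD0, hD⟩ := exists_norm_sub_vertex_le T i
  refine ⟨?_, (hf.integrable one_le_two).const_mul _⟩
  refine Integrable.mono' ((hg.integrable one_le_two).norm.const_mul D)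
    (AEStronglyMeasurable.inner (by fun_prop) hg.1) ?_
  filter_upwards [hD] with x hx
  exact (norm_inner_le_norm _ _).trans (by gcongr)

/-- The trace inequality for smooth functions. -/
lemma exists_eLpNorm_face_le : ∃ C : ℝ≥0∞, C ≠ ⊤ ∧ ∀ u : Sp (m + 1) → ℝ, ContDiff ℝ 1 u →
    eLpNorm u 2 (faceMeasure T i) ≤ C * (eLpNorm u 2 (volume.restrict (interior (cell T)))
      + eLpNorm (gradient u) 2 (volume.restrict (interior (cell T)))) := by
  obtain ⟨D, hD0, hD⟩ := exists_norm_sub_vertex_le T i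
  have hh := T.height_pos i
  set A : ℝ := (D + (m + 1)) / T.height i with hA
  have hA0 : 0 ≤ A := by positivity
  -- The square of `A + 1` dominates `A`, so no square root is needed.
  refine ⟨ENNReal.ofReal A + 1, by finiteness, fun u hu => ?_⟩
  have hu2 := Continuous.memLp_restrict_cell T hu.continuous 2
  have hg2 := Continuous.memLp_restrict_cell T (continuous_gradient hu) 2
  have huF := Continuous.memLp_faceMeasure T i hu.continuous 2
  have hi1 := hu2.integrable_norm_pow two_ne_zero
  have hi2 := hg2.integrable_norm_pow two_ne_zero
  have e1 : T.height i * ∫ x, ‖u x‖ ^ 2 ∂(faceMeasure T i)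
      ≤ (D + (m + 1)) * ∫ x in interior (cell T), (‖u x‖ ^ 2 + ‖gradient u x‖ ^ 2) := by
    -- Green's formula for `u ^ 2` has the squared `L²` norm on the face as its boundary term; the
    -- mixed term `2 * u * ∇u` is then absorbed by Young's inequality.
    have := setIntegral_cell_green T i (u := fun x => u x ^ 2) (hu.pow 2)
    rw [show ∫ x, ‖u x‖ ^ 2 ∂(faceMeasure T i) = ∫ x, u x ^ 2 ∂(faceMeasure T i) by simp,
      ← this, ← setIntegral_interior_cell, ← integral_const_mul]
    have hL := integrableOn_green T i (Continuous.memLp_restrict_cell T (hu.pow 2).continuous 2)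
      (Continuous.memLp_restrict_cell T (continuous_gradient (hu.pow 2)) 2)
    refine integral_mono_ae (hL.1.add hL.2) ((hi1.add hi2).const_mul _) ?_
    filter_upwards [hD] with x hx
    simp only [gradient_sq (hu.differentiable one_ne_zero), inner_smul_right]
    have h1 : ⟪x - T.points i, gradient u x⟫ * u x ≤ D * ‖gradient u x‖ * ‖u x‖ := by
      refine (le_abs_self _).trans ?_
      rw [abs_mul, Real.norm_eq_abs]
      gcongr
      exact (abs_real_inner_le_norm _ _).trans (by gcongr)
    have h2 : u x ^ 2 = ‖u x‖ ^ 2 := by simp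
    rw [h2]
    have h3 : 0 ≤ D * (‖u x‖ - ‖gradient u x‖) ^ 2 := by positivity
    have h4 : 0 ≤ (m + 1 : ℝ) * ‖gradient u x‖ ^ 2 := by positivity
    linarith
  have e2 : ∫ x, ‖u x‖ ^ 2 ∂(faceMeasure T i)
      ≤ A * ∫ x in interior (cell T), (‖u x‖ ^ 2 + ‖gradient u x‖ ^ 2) := by
    rw [hA, div_mul_eq_mul_div, le_div_iff₀ hh, mul_comm]; exact e1
  rw [← ENNReal.pow_le_pow_left_iff two_ne_zero, ← ofReal_integral_norm_sq huF]
  refine (ENNReal.ofReal_le_ofReal e2).trans ?_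
  rw [ENNReal.ofReal_mul hA0, integral_add hi1 hi2, ENNReal.ofReal_add
    (integral_nonneg fun _ => by positivity) (integral_nonneg fun _ => by positivity),
    ofReal_integral_norm_sq hu2, ofReal_integral_norm_sq hg2, mul_pow]
  gcongr
  · calc ENNReal.ofReal A ≤ ENNReal.ofReal A + 1 := le_self_add
      _ = (ENNReal.ofReal A + 1) * 1 := (mul_one _).symm
      _ ≤ (ENNReal.ofReal A + 1) ^ 2 := by rw [sq]; gcongr; exact le_add_self
  · rw [add_sq]
    gcongr
    exact le_self_add

/-- On a finite measure space `L²` convergence implies `L¹` convergence. The separate sequence `V`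
allows `F` to be a bounded linear image of a vector field, such as its product with `x - P`. -/
lemma tendsto_integral_of_eLpNorm_two {α E : Type*} [MeasurableSpace α] [NormedAddCommGroup E]
    {μ : Measure α} [IsFiniteMeasure μ] {F : ℕ → α → ℝ} {f : α → ℝ} {V : ℕ → α → E} {v : α → E}
    {C : ℝ} (hF : ∀ n, Integrable (F n) μ) (hf : Integrable f μ)
    (hV : ∀ n, AEStronglyMeasurable (V n) μ) (hv : AEStronglyMeasurable v μ)
    (h : ∀ n, ∀ᵐ x ∂μ, ‖F n x - f x‖ ≤ C * ‖V n x - v x‖)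
    (hlim : Tendsto (fun n => eLpNorm (V n - v) 2 μ) atTop (𝓝 0)) :
    Tendsto (fun n => ∫ x, F n x ∂μ) atTop (𝓝 (∫ x, f x ∂μ)) := by
  refine tendsto_integral_of_L1' f hf.1 (Eventually.of_forall hF) ?_
  have hb : ∀ n, eLpNorm (F n - f) 1 μ ≤ ENNReal.ofReal C *
      (eLpNorm (V n - v) 2 μ * μ Set.univ ^ (1 / (1 : ℝ≥0∞).toReal - 1 / (2 : ℝ≥0∞).toReal)) := by
    intro n
    refine (eLpNorm_le_mul_eLpNorm_of_ae_le_mul (h n) 1).trans ?_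
    gcongr
    exact eLpNorm_le_eLpNorm_mul_rpow_measure_univ one_le_two ((hV n).sub hv)
  refine tendsto_of_tendsto_of_tendsto_of_le_of_le tendsto_const_nhds ?_ (fun _ => zero_le) hb
  have := ENNReal.Tendsto.const_mul (a := ENNReal.ofReal C)
    (ENNReal.Tendsto.mul_const (b := μ Set.univ ^ (1 / (1 : ℝ≥0∞).toReal - 1 / (2 : ℝ≥0∞).toReal))
      hlim (Or.inr (by
        refine ENNReal.rpow_ne_top_of_nonneg (by norm_num) (measure_ne_top _ _)))) (Or.inr ENNReal.ofReal_ne_top)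
  simpa using this

/-- The volume side of Green's formula is continuous under `H¹` convergence. Hence the face
integrals of every smooth approximation have a limit that depends on `f` and `g` alone, with no
convergence on the face assumed. -/
lemma tendsto_face_integral {f : Sp (m + 1) → ℝ} {g : Sp (m + 1) → Sp (m + 1)}
    (hf : MemLp f 2 (volume.restrict (interior (cell T))))
    (hg : MemLp g 2 (volume.restrict (interior (cell T)))) {u : ℕ → Sp (m + 1) → ℝ}
    (hu : ∀ n, ContDiff ℝ ∞ (u n))
    (h1 : Tendsto (fun n => eLpNorm (u n - f) 2 (volume.restrict (interior (cell T)))) atTop (𝓝 0))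
    (h2 : Tendsto (fun n => eLpNorm (gradient (u n) - g) 2
      (volume.restrict (interior (cell T)))) atTop (𝓝 0)) :
    Tendsto (fun n => T.height i * ∫ x, u n x ∂(faceMeasure T i)) atTop
      (𝓝 (∫ x in interior (cell T), (⟪x - T.points i, g x⟫ + (m + 1) * f x))) := by
  obtain ⟨D, hD0, hD⟩ := exists_norm_sub_vertex_le T i
  have hu1 : ∀ n, ContDiff ℝ 1 (u n) := fun n => (hu n).of_le (by simp)
  have hun : ∀ n, MemLp (u n) 2 (volume.restrict (interior (cell T))) := fun n =>
    Continuous.memLp_restrict_cell T (hu n).continuous 2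
  have hgn : ∀ n, MemLp (gradient (u n)) 2 (volume.restrict (interior (cell T))) := fun n =>
    Continuous.memLp_restrict_cell T (continuous_gradient (hu1 n)) 2
  have hin := fun n => integrableOn_green T i (hun n) (hgn n)
  have hi := integrableOn_green T i hf hg
  simp_rw [← fun n => setIntegral_cell_green T i (hu1 n), ← setIntegral_interior_cell]
  rw [integral_add hi.1 hi.2]
  simp_rw [fun n => integral_add (hin n).1 (hin n).2]
  refine Tendsto.add ?_ ?_
  · refine tendsto_integral_of_eLpNorm_two (C := D) (fun n => (hin n).1) hi.1
      (fun n => (hgn n).1) hg.1 (fun n => ?_) h2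
    filter_upwards [hD] with x hx
    rw [← inner_sub_right]
    exact (norm_inner_le_norm _ _).trans (by gcongr)
  · refine tendsto_integral_of_eLpNorm_two (C := m + 1) (fun n => (hin n).2) hi.2
      (fun n => (hun n).1) hf.1 (fun n => ae_of_all _ fun x => ?_) h1
    rw [← mul_sub, norm_mul, Real.norm_of_nonneg (by positivity)]

/-- Green's formula for traces. -/
lemma IsFaceTrace.green {f g : Sp (m + 1) → ℝ} (hf : f ∈ H1 (interior (cell T)))
    (h : IsFaceTrace T i f g) :
    T.height i * ∫ x, g x ∂(faceMeasure T i) = ∫ x in interior (cell T),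
      (⟪x - T.points i, weakGrad (interior (cell T)) f x⟫ + (m + 1) * f x) := by
  obtain ⟨hg, u, hu, h1, h2, h3⟩ := h
  refine tendsto_nhds_unique (Tendsto.const_mul _ ?_)
    (tendsto_face_integral T i hf.1 (weakGrad_spec hf).1 hu h1 h2)
  have hun : ∀ n, MemLp (u n) 2 (faceMeasure T i) := fun n =>
    Continuous.memLp_faceMeasure T i (hu n).continuous 2
  exact tendsto_integral_of_eLpNorm_two (C := 1) (fun n => (hun n).integrable one_le_two)
    (hg.integrable one_le_two) (fun n => (hun n).1) hg.1
    (fun n => ae_of_all _ fun x => (one_mul _).ge) h3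

/-- The geometric rate serves to make the face restrictions Cauchy with a summable bound when traces
are constructed. -/
lemma exists_tendsto_of_starShaped {d : ℕ} {K : Set (Sp d)} (hK : IsCompact K) {c : Sp d}
    (hc : ∀ x ∈ K, ∀ s : ℝ, 0 ≤ s → s < 1 → c + s • (x - c) ∈ interior K)
    {f : Sp d → ℝ} {g : Sp d → Sp d} (hf : MemLp f 2 (volume.restrict (interior K)))
    (hg : MemLp g 2 (volume.restrict (interior K))) (hfg : HasWeakGrad (interior K) f g) :
    ∃ u : ℕ → Sp d → ℝ, (∀ n, ContDiff ℝ ∞ (u n)) ∧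
      (∀ n, eLpNorm (u n - f) 2 (volume.restrict (interior K)) ≤ 2⁻¹ ^ n) ∧
      (∀ n, eLpNorm (gradient (u n) - g) 2 (volume.restrict (interior K)) ≤ 2⁻¹ ^ n) := by
  have := fun n : ℕ => exists_contDiff_eLpNorm_sub_le hK hc hf hg hfg (η := 2⁻¹ ^ n)
    (pow_ne_zero _ (by simp))
  choose u h1 h2 h3 using this
  exact ⟨u, h1, h2, h3⟩

lemma tendsto_zero_of_le_two_inv_pow {a : ℕ → ℝ≥0∞} (h : ∀ n, a n ≤ 2⁻¹ ^ n) :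
    Tendsto a atTop (𝓝 0) :=
  tendsto_of_tendsto_of_tendsto_of_le_of_le tendsto_const_nhds
    (ENNReal.tendsto_pow_atTop_nhds_zero_of_lt_one (by simp)) (fun _ => zero_le) h

lemma starShaped_of_convex {d : ℕ} {K : Set (Sp d)} (hK : Convex ℝ K) {c : Sp d}
    (hc : c ∈ interior K) :
    ∀ x ∈ K, ∀ s : ℝ, 0 ≤ s → s < 1 → c + s • (x - c) ∈ interior K := by
  intro x hx s hs hs1
  have := hK.combo_interior_self_mem_interior hc hx (a := 1 - s) (b := s) (by linarith) hs (by ring)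
  convert! this using 1
  module

/-- Existence of traces. -/
theorem exists_isFaceTrace {f : Sp (m + 1) → ℝ} (hf : f ∈ H1 (interior (cell T))) :
    ∃ g, IsFaceTrace T i f g := by
  obtain ⟨hg, hfg⟩ := weakGrad_spec hf
  obtain ⟨c, hc⟩ := interior_cell_nonempty T
  obtain ⟨u, hu, h1, h2⟩ := exists_tendsto_of_starShaped (isCompact_cell T)
    (starShaped_of_convex (convex_cell T) hc) hf.1 hg hfg
  obtain ⟨C, hC, htr⟩ := exists_eLpNorm_face_le T i
  have hu1 : ∀ n, ContDiff ℝ 1 (u n) := fun n => (hu n).of_le (by simp)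
  have hsum : ∀ {F : Type} [NormedAddCommGroup F] {V : ℕ → Sp (m + 1) → F} {v : Sp (m + 1) → F},
      (∀ n, AEStronglyMeasurable (V n) (volume.restrict (interior (cell T)))) →
      AEStronglyMeasurable v (volume.restrict (interior (cell T))) →
      (∀ n, eLpNorm (V n - v) 2 (volume.restrict (interior (cell T))) ≤ 2⁻¹ ^ n) →
      ∀ N n k : ℕ, N ≤ n → N ≤ k →
        eLpNorm (V n - V k) 2 (volume.restrict (interior (cell T))) ≤ 2 * 2⁻¹ ^ N := by
    intro F _ V v hV hv hVv N n k hn hk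
    have hp : ∀ {n : ℕ}, N ≤ n → (2⁻¹ : ℝ≥0∞) ^ n ≤ 2⁻¹ ^ N := fun h =>
      pow_le_pow_right_of_le_one' (by simp) h
    calc eLpNorm (V n - V k) 2 (volume.restrict (interior (cell T)))
        = eLpNorm ((V n - v) - (V k - v)) 2 (volume.restrict (interior (cell T))) := by
          rw [sub_sub_sub_cancel_right]
      _ ≤ _ := eLpNorm_sub_le ((hV n).sub hv) ((hV k).sub hv) one_le_two
      _ ≤ 2⁻¹ ^ N + 2⁻¹ ^ N := add_le_add ((hVv n).trans (hp hn)) ((hVv k).trans (hp hk))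
      _ = 2 * 2⁻¹ ^ N := (two_mul _).symm
  -- The trace inequality for `u n - u k` makes the restrictions Cauchy. The `4` collects `2` for
  -- the functions and `2` for the gradients; the `+ 1` provides the strict inequality required
  -- here, even if `C = 0`.
  obtain ⟨g, hgL, hglim⟩ := Lp.cauchy_complete_eLpNorm (μ := faceMeasure T i) one_le_two
    (fun n => Continuous.memLp_faceMeasure T i (hu n).continuous 2)
    (B := fun N => (C * 4 + 1) * 2⁻¹ ^ N) (by
      rw [ENNReal.tsum_mul_left, ENNReal.tsum_geometric]
      simp only [ENNReal.one_sub_inv_two, inv_inv]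
      finiteness) (fun N n k hn hk => by
      have e1 := hsum (fun n => (hu n).continuous.aestronglyMeasurable) hf.1.1 h1 N n k hn hk
      have e2 := hsum (fun n => (continuous_gradient (hu1 n)).aestronglyMeasurable) hg.1 h2 N n k
        hn hk
      have e3 := htr (u n - u k) ((hu1 n).sub (hu1 k))
      rw [gradient_sub' ((hu1 n).differentiable one_ne_zero)
        ((hu1 k).differentiable one_ne_zero)] at e3
      calc _ ≤ _ := e3
        _ ≤ C * (2 * 2⁻¹ ^ N + 2 * 2⁻¹ ^ N) := by gcongr
        _ = C * 4 * 2⁻¹ ^ N := by ring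
        _ < C * 4 * 2⁻¹ ^ N + 2⁻¹ ^ N := by
          refine ENNReal.lt_add_right (by finiteness) (pow_ne_zero _ (by simp))
        _ = (C * 4 + 1) * 2⁻¹ ^ N := by ring)
  exact ⟨g, hgL, u, hu, tendsto_zero_of_le_two_inv_pow h1, tendsto_zero_of_le_two_inv_pow h2, hglim⟩

lemma isFaceTrace_faceTrace {f : Sp (m + 1) → ℝ} (hf : f ∈ H1 (interior (cell T))) :
    IsFaceTrace T i f (faceTrace T i f) := by
  rw [faceTrace, dif_pos (exists_isFaceTrace T i hf)]
  exact (exists_isFaceTrace T i hf).choose_spec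

lemma integrable_faceTrace {f : Sp (m + 1) → ℝ} (hf : f ∈ H1 (interior (cell T))) :
    Integrable (faceTrace T i f) (faceMeasure T i) :=
  (isFaceTrace_faceTrace T i hf).1.integrable one_le_two

/-- The integral of the trace, for any weak gradient. -/
lemma integral_faceTrace {f : Sp (m + 1) → ℝ} {g : Sp (m + 1) → Sp (m + 1)}
    (hf : MemLp f 2 (volume.restrict (interior (cell T))))
    (hg : MemLp g 2 (volume.restrict (interior (cell T))))
    (hfg : HasWeakGrad (interior (cell T)) f g) :
    T.height i * ∫ x, faceTrace T i f x ∂(faceMeasure T i) =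
      ∫ x in interior (cell T), (⟪x - T.points i, g x⟫ + (m + 1) * f x) := by
  have hfH : f ∈ H1 (interior (cell T)) := ⟨hf, g, hg, hfg⟩
  rw [(isFaceTrace_faceTrace T i hfH).green T i hfH]
  refine integral_congr_ae ?_
  filter_upwards [HasWeakGrad.ae_eq isOpen_interior
    ((isCompact_cell T).isBounded.subset interior_subset) (weakGrad_spec hfH).1 hg
    (weakGrad_spec hfH).2 hfg] with x hx
  rw [hx]

end trace

/-! ### Faces shared by two simplices -/

section shared

variable {d : ℕ}

lemma affineMap_eq_sum_coord (T : Simp d) (a : Sp d →ᵃ[ℝ] ℝ) (x : Sp d) :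
    a x = ∑ j, (vertexBasis T).coord j x * a (T.points j) := by
  have h1 := (vertexBasis T).sum_coord_apply_eq_one x
  have h2 := (vertexBasis T).affineCombination_coord_eq_self x
  conv_lhs => rw [← h2]
  rw [Finset.map_affineCombination _ _ _ h1,
    Finset.affineCombination_eq_linear_combination _ _ _ h1]
  rfl

lemma vertex_mem_face (T : Simp d) {i j : Fin (d + 1)} (hj : j ≠ i) : T.points j ∈ face T i :=
  subset_convexHull _ _ ⟨j, hj, rfl⟩

lemma coord_vertex_self (T : Simp d) (j : Fin (d + 1)) :
    (vertexBasis T).coord j (T.points j) = 1 := (vertexBasis T).coord_apply_eq j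

lemma coord_vertex_ne (T : Simp d) {i j : Fin (d + 1)} (hj : i ≠ j) :
    (vertexBasis T).coord i (T.points j) = 0 := (vertexBasis T).coord_apply_ne hj

/-- Being in the relative interior of a face. -/
def InFaceInterior (T : Simp d) (i : Fin (d + 1)) (x : Sp d) : Prop :=
  (vertexBasis T).coord i x = 0 ∧ ∀ j ≠ i, 0 < (vertexBasis T).coord j x

lemma InFaceInterior.mem_face {T : Simp d} {i : Fin (d + 1)} {x : Sp d}
    (h : InFaceInterior T i x) : x ∈ face T i := by
  refine (mem_face_iff T i x).2 ⟨(mem_cell_iff T x).2 fun j => ?_, h.1⟩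
  rcases eq_or_ne j i with rfl | hj
  · exact h.1.ge
  · exact (h.2 j hj).le

lemma exists_inFaceInterior [NeZero d] (T : Simp d) (i : Fin (d + 1)) :
    ∃ c, InFaceInterior T i c := by
  set w : Fin (d + 1) → ℝ := fun j => if j = i then 0 else (d : ℝ)⁻¹ with hw
  have hd : (d : ℝ) ≠ 0 := Nat.cast_ne_zero.2 (NeZero.ne d)
  have hw1 : ∑ j, w j = 1 := by
    rw [hw, ← Finset.sum_erase_add _ _ (Finset.mem_univ i)]
    rw [Finset.sum_congr rfl (g := fun _ => (d : ℝ)⁻¹) fun j hj => if_neg (Finset.ne_of_mem_erase hj)]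
    simp [hd]
  refine ⟨Finset.univ.affineCombination ℝ (vertexBasis T) w, ?_, fun j hj => ?_⟩
  · rw [(vertexBasis T).coord_apply_combination_of_mem (Finset.mem_univ i) hw1]; simp [hw]
  · rw [(vertexBasis T).coord_apply_combination_of_mem (Finset.mem_univ j) hw1]
    simp [hw, hj, Nat.pos_of_ne_zero (NeZero.ne d)]

section pair

variable {T T' : Simp d} {i i' : Fin (d + 1)} (hF : face T i = face T' i')
include hF

/-- A coordinate of `T'` is nonnegative at the vertices of the common face, and `x` is a combination
of these with positive weights. If it vanished at `x` it would vanish on the whole face, which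
contradicts its value `1` at the `k`-th vertex of `T'`. -/
lemma InFaceInterior.of_face_eq {x : Sp d} (hx : InFaceInterior T i x) :
    InFaceInterior T' i' x := by
  have hx' := (mem_face_iff T' i' x).1 (hF ▸ hx.mem_face)
  refine ⟨hx'.2, fun k hk => lt_of_le_of_ne ((mem_cell_iff T' x).1 hx'.1 k) fun h0 => ?_⟩
  have hv : ∀ j ≠ i, 0 ≤ (vertexBasis T').coord k (T.points j) := fun j hj =>
    (mem_cell_iff T' _).1 (face_subset_cell T' i' (hF ▸ vertex_mem_face T hj)) k
  have h1 := affineMap_eq_sum_coord T ((vertexBasis T').coord k) x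
  rw [← h0, eq_comm, Finset.sum_eq_zero_iff_of_nonneg] at h1
  · have h2 : face T i ⊆ {y | (vertexBasis T').coord k y = 0} := by
      refine convexHull_min ?_ ((convex_singleton (0 : ℝ)).affine_preimage _)
      rintro _ ⟨j, hj, rfl⟩
      exact (mul_eq_zero.1 (h1 j (Finset.mem_univ j))).resolve_left (hx.2 j hj).ne'
    have h3 := h2 (hF ▸ vertex_mem_face T' hk)
    have h4 := coord_vertex_self T' k
    rw [h3] at h4
    exact zero_ne_one h4
  · intro j _
    rcases eq_or_ne j i with rfl | hj
    · rw [hx.1, zero_mul]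
    · exact mul_nonneg (hx.2 j hj).le (hv j hj)

/-- Two simplices without overlap lie on opposite sides of a common face. -/
lemma exists_coord_eq_neg_mul [NeZero d] (hdis : Disjoint (interior (cell T)) (interior (cell T'))) :
    ∃ α < 0, ∀ x, (vertexBasis T').coord i' x = α * (vertexBasis T).coord i x := by
  set α := (vertexBasis T').coord i' (T.points i) with hα
  -- The affine function on the left vanishes at every vertex of `T` on the common face, so only the
  -- vertex opposite to it contributes to its barycentric expansion.
  have hcoord : ∀ x, (vertexBasis T').coord i' x = α * (vertexBasis T).coord i x := by
    intro x
    rw [affineMap_eq_sum_coord T, Finset.sum_eq_single i, mul_comm]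
    · intro j _ hj
      rw [((mem_face_iff T' i' _).1 (hF ▸ vertex_mem_face T hj)).2, mul_zero]
    · simp
  refine ⟨α, ?_, hcoord⟩
  have hα0 : α ≠ 0 := by
    intro h0
    have := hcoord (T'.points i')
    rw [coord_vertex_self, h0, zero_mul] at this
    exact one_ne_zero this
  -- If `α` were positive, points slightly off `c` in the direction of the opposite vertex of `T`
  -- would be interior to both simplices.
  by_contra hneg
  have hpos : 0 < α := lt_of_le_of_ne (not_lt.1 hneg) hα0.symm
  obtain ⟨c, hc⟩ := exists_inFaceInterior T i
  have hc' := hc.of_face_eq hF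
  have hlim : ∀ k ≠ i', ∀ᶠ s : ℝ in 𝓝[>] 0,
      0 < (vertexBasis T').coord k (c + s • (T.points i - c)) := by
    intro k hk
    have hcont : Continuous fun s : ℝ => (vertexBasis T').coord k (c + s • (T.points i - c)) := by
      simp_rw [coord_combo]; fun_prop
    have := hcont.tendsto 0
    rw [zero_smul, add_zero] at this
    exact (this.mono_left nhdsWithin_le_nhds).eventually_const_lt (hc'.2 k hk)
  have hev : ∀ᶠ s : ℝ in 𝓝[>] 0, ∀ k, k ≠ i' →
      0 < (vertexBasis T').coord k (c + s • (T.points i - c)) :=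
    eventually_all.2 fun k => by
      by_cases hk : k = i'
      · simp [hk]
      · simpa [hk] using hlim k hk
  obtain ⟨s, hs, hs0, hs1⟩ := (hev.and (Ioo_mem_nhdsGT (zero_lt_one (α := ℝ)))).exists
  have hi : (vertexBasis T).coord i (c + s • (T.points i - c)) = s := by
    rw [coord_combo, hc.1, coord_vertex_self]; ring
  have hmem : c + s • (T.points i - c) ∈ interior (cell T) := by
    refine (mem_interior_cell_iff T _).2 fun j => ?_
    rcases eq_or_ne j i with rfl | hj
    · rw [hi]; exact hs0
    · rw [coord_combo, coord_vertex_ne T hj, mul_zero, add_zero]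
      exact mul_pos (by linarith) (hc.2 j hj)
  refine Set.disjoint_left.1 hdis hmem ?_
  refine (mem_interior_cell_iff T' _).2 fun k => ?_
  rcases eq_or_ne k i' with rfl | hk
  · rw [hcoord, hi]; exact mul_pos hpos hs0
  · exact hs k hk

/-- The gradient of the `i`-th barycentric coordinate is minus the normal divided by the height.
Proportionality with a negative factor makes the two normals antiparallel, and both are unit
vectors. -/
lemma normal_eq_neg_of_face_eq [NeZero d]
    (hdis : Disjoint (interior (cell T)) (interior (cell T'))) :
    normal T' i' = -normal T i := by
  obtain ⟨α, hα, h⟩ := exists_coord_eq_neg_mul hF hdis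
  have hh := T.height_pos i
  have hh' := T'.height_pos i'
  have key : (T'.height i')⁻¹ • normal T' i' = (α * (T.height i)⁻¹) • normal T i := by
    refine ext_inner_right ℝ fun v => ?_
    have h1 := h (v + T.points i)
    have h2 := h (T.points i)
    rw [coord_eq_one_sub, coord_eq_one_sub] at h1 h2
    simp only [inner_sub_right, inner_add_right] at h1 h2
    rw [inner_smul_left, inner_smul_left]
    simp only [RCLike.conj_to_real]
    field_simp at h1 h2 ⊢
    linarith
  have hn := congrArg norm key
  rw [norm_smul, norm_smul, norm_normal, norm_normal, mul_one, mul_one, Real.norm_eq_abs,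
    Real.norm_eq_abs, abs_mul, abs_of_neg hα, abs_of_pos (inv_pos.2 hh'),
    abs_of_pos (inv_pos.2 hh)] at hn
  have : (T'.height i')⁻¹ • normal T' i' = (T'.height i')⁻¹ • (-normal T i) := by
    rw [key, hn]; module
  exact smul_right_injective _ (inv_pos.2 hh').ne' this

/-- Near `x` the coordinates belonging to the vertices of the face stay positive in both simplices,
and the two remaining ones are negative multiples of each other, so every nearby point lies in one
of the simplices. -/
lemma InFaceInterior.mem_interior_union [NeZero d]
    (hdis : Disjoint (interior (cell T)) (interior (cell T'))) {x : Sp d}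
    (hx : InFaceInterior T i x) : x ∈ interior (cell T ∪ cell T') := by
  obtain ⟨α, hα, h⟩ := exists_coord_eq_neg_mul hF hdis
  have hx' := hx.of_face_eq hF
  have hopen : ∀ (S : Simp d) (k : Fin (d + 1)),
      IsOpen {y | ∀ j, j ≠ k → 0 < (vertexBasis S).coord j y} := by
    intro S k
    simp only [Set.ofPred_forall]
    refine isOpen_iInter_of_finite fun j => isOpen_iInter_of_finite fun _ => ?_
    exact isOpen_lt continuous_const (continuous_barycentric_coord (vertexBasis S) j)
  refine mem_interior.2 ⟨_, ?_, (hopen T i).inter (hopen T' i'), hx.2, hx'.2⟩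
  rintro y ⟨hy, hy'⟩
  rcases le_or_gt 0 ((vertexBasis T).coord i y) with h0 | h0
  · refine Or.inl ((mem_cell_iff T y).2 fun j => ?_)
    rcases eq_or_ne j i with rfl | hj
    · exact h0
    · exact (hy j hj).le
  · refine Or.inr ((mem_cell_iff T' y).2 fun j => ?_)
    rcases eq_or_ne j i' with rfl | hj
    · rw [h]; exact (mul_pos_of_neg_of_neg hα h0).le
    · exact (hy' j hj).le

/-- The union of two simplices sharing a face is star-shaped about each point in the relative
interior of that face. -/
lemma starShaped_union [NeZero d] (hdis : Disjoint (interior (cell T)) (interior (cell T')))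
    {c : Sp d} (hc : InFaceInterior T i c) :
    ∀ x ∈ cell T ∪ cell T', ∀ s : ℝ, 0 ≤ s → s < 1 →
      c + s • (x - c) ∈ interior (cell T ∪ cell T') := by
  have main : ∀ {S S' : Simp d} {k k' : Fin (d + 1)}, face S k = face S' k' →
      Disjoint (interior (cell S)) (interior (cell S')) → InFaceInterior S k c →
      ∀ x ∈ cell S, ∀ s : ℝ, 0 ≤ s → s < 1 →
      c + s • (x - c) ∈ interior (cell S ∪ cell S') := by
    intro S S' k k' hS hdS hcS x hx s hs hs1
    rw [mem_cell_iff] at hx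
    have hpos : ∀ j ≠ k, 0 < (vertexBasis S).coord j (c + s • (x - c)) := by
      intro j hj
      rw [coord_combo]
      exact add_pos_of_pos_of_nonneg (mul_pos (by linarith) (hcS.2 j hj)) (mul_nonneg hs (hx j))
    have hk : 0 ≤ (vertexBasis S).coord k (c + s • (x - c)) := by
      rw [coord_combo, hcS.1, mul_zero, zero_add]
      exact mul_nonneg hs (hx k)
    -- The contracted point is either in the relative interior of the face or in the interior of its
    -- own simplex.
    rcases hk.eq_or_lt with h0 | h0
    · exact InFaceInterior.mem_interior_union hS hdS ⟨h0.symm, hpos⟩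
    · refine interior_mono Set.subset_union_left ((mem_interior_cell_iff S _).2 fun j => ?_)
      rcases eq_or_ne j k with rfl | hj
      · exact h0
      · exact hpos j hj
  rintro x (hx | hx) s hs hs1
  · exact main hF hdis hc x hx s hs hs1
  · rw [Set.union_comm]
    exact main hF.symm hdis.symm (hc.of_face_eq hF) x hx s hs hs1

lemma faceMeasure_eq_of_face_eq : faceMeasure T i = faceMeasure T' i' := by
  rw [faceMeasure, faceMeasure, hF]

end pair

lemma face_injective (T : Simp d) : Function.Injective (face T) := by
  intro i j hij
  by_contra hne
  have h := ((mem_face_iff T j _).1 (hij ▸ vertex_mem_face T (Ne.symm hne))).2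
  rw [coord_vertex_self] at h
  exact one_ne_zero h

/-- The traces from both sides of an `H¹` function have the same integral. -/
lemma integral_faceTrace_eq_of_face_eq {m : ℕ} {T T' : Simp (m + 1)} {i i' : Fin (m + 1 + 1)}
    (hF : face T i = face T' i') (hdis : Disjoint (interior (cell T)) (interior (cell T')))
    {f : Sp (m + 1) → ℝ} (hf : f ∈ H1 (interior (cell T ∪ cell T'))) :
    ∫ x, faceTrace T i f x ∂(faceMeasure T i) = ∫ x, faceTrace T' i' f x ∂(faceMeasure T' i') := by
  obtain ⟨c, hc⟩ := exists_inFaceInterior T i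
  obtain ⟨hfL, g, hg, hfg⟩ := hf
  obtain ⟨u, hu, h1, h2⟩ := exists_tendsto_of_starShaped ((isCompact_cell T).union (isCompact_cell T'))
    (starShaped_union hF hdis hc) hfL hg hfg
  -- The sequence approximates `f` on the union, hence on each of the two simplices, so its face
  -- integrals tend to the trace integral taken from either side.
  have main : ∀ {S : Simp (m + 1)} (k : Fin (m + 1 + 1)), cell S ⊆ cell T ∪ cell T' →
      Tendsto (fun n => ∫ x, u n x ∂(faceMeasure S k)) atTop
        (𝓝 (∫ x, faceTrace S k f x ∂(faceMeasure S k))) := by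
    intro S k hS
    have hU := interior_mono hS
    have hμ := Measure.restrict_mono_set (volume : Measure (Sp (m + 1))) hU
    have hle : ∀ {E : Type} [NormedAddCommGroup E] (v : Sp (m + 1) → E),
        eLpNorm v 2 (volume.restrict (interior (cell S)))
          ≤ eLpNorm v 2 (volume.restrict (interior (cell T ∪ cell T'))) :=
      fun v => eLpNorm_mono_measure v hμ
    have h := tendsto_face_integral S k (hfL.mono_measure hμ) (hg.mono_measure hμ) hu
      (tendsto_zero_of_le_two_inv_pow fun n => (hle _).trans (h1 n))
      (tendsto_zero_of_le_two_inv_pow fun n => (hle _).trans (h2 n))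
    rw [← integral_faceTrace S k (hfL.mono_measure hμ) (hg.mono_measure hμ) (hfg.mono hU)] at h
    have hh := (S.height_pos k).ne'
    simpa [hh] using h.const_mul (S.height k)⁻¹
  have hT := main i Set.subset_union_left
  have hT' := main (S := T') i' Set.subset_union_right
  rw [← faceMeasure_eq_of_face_eq hF] at hT' ⊢
  exact tendsto_nhds_unique hT hT'

end shared

/-! ### Faces of a mesh -/

section mesh

variable {d : ℕ} [NeZero d] {Ω : Set (Sp d)}

omit [NeZero d] in
lemma Mesh.cell_subset (M : Mesh Ω) {T : Simp d} (hT : T ∈ M.cells) : cell T ⊆ closure Ω := by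
  rw [M.cover]; exact Set.subset_biUnion_of_mem (u := cell) hT

-- The face has `d` vertices, so exactly one of the `d + 1` vertices of `T'` is missing among them.
omit [NeZero d] in
lemma exists_face_eq_of_range_subset {T T' : Simp d} {i : Fin (d + 1)}
    (h : T.points '' {i}ᶜ ⊆ Set.range T'.points) : ∃ i', face T' i' = face T i := by
  set A : Set (Fin (d + 1)) := T'.points ⁻¹' (T.points '' {i}ᶜ) with hA
  have hAim : T'.points '' A = T.points '' {i}ᶜ := Set.image_preimage_eq_of_subset h
  have hcard : A.ncard = d := by
    rw [← Set.ncard_image_of_injective A T'.independent.injective, hAim,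
      Set.ncard_image_of_injective _ T.independent.injective, Set.ncard_compl]
    simp
  obtain ⟨i', hi'⟩ : ∃ i', Aᶜ = {i'} := by
    rw [← Set.ncard_eq_one, Set.ncard_compl, hcard]; simp
  refine ⟨i', ?_⟩
  rw [face, face, ← hAim, ← hi', compl_compl]

/-- A face which is not on the boundary is shared with another simplex of the mesh. -/
lemma Mesh.exists_neighbour (hΩ : IsOpen Ω) (M : Mesh Ω) {T : Simp d} (hT : T ∈ M.cells)
    {i : Fin (d + 1)} (hi : ¬ face T i ⊆ frontier Ω) :
    ∃ T' ∈ M.cells, T' ≠ T ∧ ∃ i', face T' i' = face T i := by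
  obtain ⟨y, hy, hyf⟩ := Set.not_subset.1 hi
  have hyΩ : y ∈ Ω := by
    have := M.cell_subset hT (face_subset_cell T i hy)
    by_contra hn
    exact hyf ⟨this, fun h => hn (interior_subset h)⟩
  -- A point of the face in the open set `Ω` can be moved slightly towards the relative interior of
  -- the face without leaving `Ω`.
  obtain ⟨x, hx, hxΩ⟩ : ∃ x, InFaceInterior T i x ∧ x ∈ Ω := by
    obtain ⟨c, hc⟩ := exists_inFaceInterior T i
    have hcont : Continuous fun s : ℝ => y + s • (c - y) := by fun_prop
    have h1 : ∀ᶠ s : ℝ in 𝓝[>] 0, y + s • (c - y) ∈ Ω := by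
      have := hcont.tendsto 0
      rw [zero_smul, add_zero] at this
      exact (this.mono_left nhdsWithin_le_nhds).eventually (hΩ.mem_nhds hyΩ)
    obtain ⟨s, hs, hs0, hs1⟩ := (h1.and (Ioo_mem_nhdsGT (zero_lt_one (α := ℝ)))).exists
    have hyc := (mem_face_iff T i y).1 hy
    refine ⟨_, ⟨?_, fun j hj => ?_⟩, hs⟩
    · rw [coord_combo, hc.1, hyc.2]; ring
    · rw [coord_combo]
      exact add_pos_of_nonneg_of_pos (mul_nonneg (by linarith) ((mem_cell_iff T y).1 hyc.1 j))
        (mul_pos hs0 (hc.2 j hj))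
  -- Otherwise a neighbourhood of `x` in `Ω` avoids all the other closed cells and lies in `cell T`,
  -- although the `i`-th coordinate of `x` is zero.
  obtain ⟨T', hT', hne, hxT'⟩ : ∃ T' ∈ M.cells, T' ≠ T ∧ x ∈ cell T' := by
    classical
    by_contra! hcon
    have hopen : IsOpen (Ω ∩ ⋂ T' ∈ M.cells.erase T, (cell T')ᶜ) :=
      hΩ.inter (isOpen_biInter_finset fun T' _ => (isCompact_cell T').isClosed.isOpen_compl)
    have hxi : x ∈ interior (cell T) := by
      refine mem_interior.2 ⟨_, ?_, hopen, hxΩ, ?_⟩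
      · rintro z ⟨hz, hz'⟩
        have := subset_closure hz
        rw [M.cover] at this
        simp only [Set.mem_iUnion, exists_prop] at this
        obtain ⟨S, hS, hzS⟩ := this
        by_cases hST : S = T
        · exact hST ▸ hzS
        · exact absurd hzS (Set.mem_iInter₂.1 hz' S (Finset.mem_erase.2 ⟨hST, hS⟩))
      · exact Set.mem_iInter₂.2 fun S hS =>
          hcon S (Finset.mem_of_mem_erase hS) (Finset.ne_of_mem_erase hS)
    exact ((mem_interior_cell_iff T x).1 hxi i).ne' hx.1
  refine ⟨T', hT', hne, exists_face_eq_of_range_subset ?_⟩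
  -- By conformity `x` is in the hull of the common vertices. All its coordinates except the `i`-th
  -- are positive, so every vertex of the face must be common.
  have hmem : x ∈ cell T ∩ cell T' := ⟨face_subset_cell T i hx.mem_face, hxT'⟩
  rw [M.conformal T hT T' hT' hne.symm, ← Set.image_univ, ← Set.image_inter_preimage,
    Set.univ_inter, mem_convexHull_image_vertices_iff] at hmem
  rintro _ ⟨j, hj, rfl⟩
  by_contra hjn
  exact (hx.2 j hj).ne' (hmem.2 j hjn)

/-- If three different simplices shared a face, their three outer unit normals would be pairwise
opposite, which is impossible. -/
lemma Mesh.neighbour_unique (M : Mesh Ω) {T T' T'' : Simp d} (hT : T ∈ M.cells)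
    (hT' : T' ∈ M.cells) (hT'' : T'' ∈ M.cells) (hne' : T' ≠ T) (hne'' : T'' ≠ T)
    {i i' i'' : Fin (d + 1)} (h' : face T' i' = face T i) (h'' : face T'' i'' = face T i) :
    T' = T'' ∧ i' = i'' := by
  have hTT : T' = T'' := by
    by_contra hne
    have h1 := normal_eq_neg_of_face_eq h'.symm (M.disjoint T hT T' hT' hne'.symm)
    have h2 := normal_eq_neg_of_face_eq h''.symm (M.disjoint T hT T'' hT'' hne''.symm)
    have h3 := normal_eq_neg_of_face_eq (h''.trans h'.symm)
      (M.disjoint T'' hT'' T' hT' (Ne.symm hne))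
    rw [h1, h2, eq_neg_iff_add_eq_zero, ← neg_add, neg_eq_zero, ← two_smul ℝ] at h3
    have h4 := norm_normal T i
    rw [(smul_eq_zero.1 h3).resolve_left two_ne_zero, norm_zero] at h4
    exact zero_ne_one h4
  subst hTT
  exact ⟨rfl, face_injective T' (h'.trans h''.symm)⟩

/-- Sums over all faces of all simplices of terms that cancel on shared faces. -/
theorem Mesh.sum_faces_eq_sum_boundaryFaces (hΩ : IsOpen Ω) (M : Mesh Ω)
    (a : Simp d → Fin (d + 1) → ℝ)
    (ha : ∀ T ∈ M.cells, ∀ T' ∈ M.cells, T ≠ T' → ∀ i i', face T i = face T' i' →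
      a T i + a T' i' = 0) :
    ∑ T ∈ M.cells, ∑ i, a T i = ∑ F ∈ M.boundaryFaces, a F.1 F.2 := by
  classical
  rw [← Finset.sum_product', ← Finset.sum_filter_add_sum_filter_not (M.cells ×ˢ Finset.univ)
    (fun F => face F.1 F.2 ⊆ frontier Ω)]
  have hb : M.boundaryFaces = (M.cells ×ˢ Finset.univ).filter
      fun F => face F.1 F.2 ⊆ frontier Ω := by
    unfold Mesh.boundaryFaces; congr
  rw [hb, add_eq_left]
  have hex : ∀ F ∈ (M.cells ×ˢ Finset.univ).filter (fun F : Simp d × Fin (d + 1) =>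
      ¬ face F.1 F.2 ⊆ frontier Ω), ∃ G : Simp d × Fin (d + 1), G.1 ∈ M.cells ∧ G.1 ≠ F.1 ∧
        face G.1 G.2 = face F.1 F.2 := by
    intro F hF
    simp only [Finset.mem_filter, Finset.mem_product, Finset.mem_univ, and_true] at hF
    obtain ⟨T', hT', hne, i', h⟩ := M.exists_neighbour hΩ hF.1 hF.2
    exact ⟨(T', i'), hT', hne, h⟩
  choose! g hg using hex
  have hmem : ∀ F ∈ (M.cells ×ˢ Finset.univ).filter (fun F : Simp d × Fin (d + 1) =>
      ¬ face F.1 F.2 ⊆ frontier Ω), g F ∈ (M.cells ×ˢ Finset.univ).filter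
        (fun F : Simp d × Fin (d + 1) => ¬ face F.1 F.2 ⊆ frontier Ω) := by
    intro F hF
    have h := hg F hF
    simp only [Finset.mem_filter, Finset.mem_product, Finset.mem_univ, and_true] at hF ⊢
    exact ⟨h.1, h.2.2 ▸ hF.2⟩
  have hcell : ∀ F ∈ (M.cells ×ˢ Finset.univ).filter (fun F : Simp d × Fin (d + 1) =>
      ¬ face F.1 F.2 ⊆ frontier Ω), F.1 ∈ M.cells := fun F hF =>
    (Finset.mem_product.1 (Finset.mem_filter.1 hF).1).1
  -- Crossing a face to its neighbour is an involution without fixed points on the pairs off the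
  -- boundary, and the terms of each orbit cancel.
  refine Finset.sum_involution (fun F _ => g F) ?_ ?_ (fun F hF => hmem F hF) ?_
  · intro F hF
    obtain ⟨h1, h2, h3⟩ := hg F hF
    exact ha _ (hcell F hF) _ h1 h2.symm _ _ h3.symm
  · intro F hF _ h
    exact (hg F hF).2.1 (congrArg Prod.fst h)
  · intro F hF
    obtain ⟨h1, h2, h3⟩ := hg F hF
    obtain ⟨h1', h2', h3'⟩ := hg (g F) (hmem F hF)
    have := M.neighbour_unique h1 h1' (hcell F hF) h2' h2.symm h3' h3.symm
    exact Prod.ext this.1 this.2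

end mesh

/-! ### Sobolev functions on the cells -/

section sobolev

variable {d : ℕ}

lemma HasWeakGrad.congr_ae {U : Set (Sp d)} {f f' : Sp d → ℝ} {g : Sp d → Sp d}
    (h : HasWeakGrad U f g) (hff' : f' =ᵐ[volume.restrict U] f) : HasWeakGrad U f' g := by
  intro φ hφ
  rw [← h φ hφ]
  refine integral_congr_ae ?_
  filter_upwards [hff'] with x hx
  rw [hx]

lemma IsTest.memLp_top_gradient {U : Set (Sp d)} {φ : Sp d → ℝ} (h : IsTest U φ)
    (μ : Measure (Sp d)) [IsFiniteMeasureOnCompacts μ] : MemLp (gradient φ) ⊤ μ := by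
  refine (continuous_gradient (h.1.of_le (by simp))).memLp_of_hasCompactSupport ?_
  exact (h.2.1.fderiv ℝ).comp_left (map_zero _)

lemma HasWeakGrad.add {U : Set (Sp d)} (hUb : Bornology.IsBounded U) {f f' : Sp d → ℝ}
    {g g' : Sp d → Sp d} (hf : MemLp f 2 (volume.restrict U)) (hf' : MemLp f' 2 (volume.restrict U))
    (hg : MemLp g 2 (volume.restrict U)) (hg' : MemLp g' 2 (volume.restrict U))
    (h : HasWeakGrad U f g) (h' : HasWeakGrad U f' g') : HasWeakGrad U (f + f') (g + g') := by
  have : IsFiniteMeasure (volume.restrict U) := ⟨by simpa using hUb.measure_lt_top⟩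
  intro φ hφ
  simp only [Pi.add_apply, add_smul, smul_add]
  have e1 := integral_add
    ((hf.integrable one_le_two).smul_of_top_left (hφ.memLp_top_gradient (volume.restrict U)))
    ((hf'.integrable one_le_two).smul_of_top_left (hφ.memLp_top_gradient _))
  have e2 := integral_add
    ((hg.integrable one_le_two).smul_of_top_right (hφ.memLp_top (volume.restrict U)))
    ((hg'.integrable one_le_two).smul_of_top_right (hφ.memLp_top _))
  simp only [Pi.smul_apply'] at e1 e2
  rw [e1, e2, h φ hφ, h' φ hφ, neg_add]

/-- The classical gradient is a weak gradient. -/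
lemma hasWeakGrad_gradient (U : Set (Sp d)) {u : Sp d → ℝ} (hu : ContDiff ℝ 1 u) :
    HasWeakGrad U u (gradient u) := by
  intro φ hφ
  have hφ1 : ContDiff ℝ 1 φ := hφ.1.of_le (by simp)
  have hcg := continuous_gradient hφ1
  have hcu := continuous_gradient hu
  have hsg : HasCompactSupport (gradient φ) := (hφ.2.1.fderiv ℝ).comp_left (map_zero _)
  rw [setIntegral_eq_integral_of_forall_compl_eq_zero fun x hx => by
      rw [hφ.gradient_eq_zero hx, smul_zero],
    setIntegral_eq_integral_of_forall_compl_eq_zero fun x hx => by rw [hφ.eq_zero hx, zero_smul]]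
  have i1 : Integrable fun x => u x • gradient φ x :=
    (hu.continuous.smul hcg).integrable_of_hasCompactSupport hsg.smul_left
  have i2 : Integrable fun x => φ x • gradient u x :=
    (hφ.1.continuous.smul hcu).integrable_of_hasCompactSupport hφ.2.1.smul_right
  have i3 : Integrable fun x => u x * φ x :=
    (hu.continuous.mul hφ.1.continuous).integrable_of_hasCompactSupport hφ.2.1.mul_left
  refine ext_inner_left ℝ fun v => ?_
  rw [inner_neg_right, ← integral_inner i1, ← integral_inner i2]
  have e : ∀ {f : Sp d → ℝ} (x : Sp d), ⟪v, gradient f x⟫ = fderiv ℝ f x v := by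
    intro f x
    rw [real_inner_comm, gradient, InnerProductSpace.toDual_symm_apply]
  have := integral_mul_fderiv_eq_neg_fderiv_mul_of_integrable (𝕜 := ℝ) (μ := volume) (f := u)
    (g := φ) (v := v) ?_ ?_ i3
    (fun x _ => hu.differentiable one_ne_zero x) fun x _ => hφ1.differentiable one_ne_zero x
  · simp only [inner_smul_right, e]
    rw [this]
    simp only [mul_comm]
  · refine (i2.inner_const v).congr (ae_of_all _ fun x => ?_)
    simp only [real_inner_comm, inner_smul_right, e, mul_comm]
  · refine (i1.inner_const v).congr (ae_of_all _ fun x => ?_)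
    simp only [real_inner_comm, inner_smul_right, e]

lemma Continuous.memLp_restrict_of_isBounded {E : Type*} [NormedAddCommGroup E] {U : Set (Sp d)}
    (hU : MeasurableSet U) (hUb : Bornology.IsBounded U) {v : Sp d → E} (hv : Continuous v)
    (p : ℝ≥0∞) : MemLp v p (volume.restrict U) := by
  have : IsFiniteMeasure (volume.restrict U) := ⟨by simpa using hUb.measure_lt_top⟩
  obtain ⟨C, hC⟩ := hUb.isCompact_closure.exists_bound_of_continuousOn hv.continuousOn
  refine MemLp.of_bound hv.aestronglyMeasurable C ?_
  filter_upwards [ae_restrict_mem hU] with x hx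
  exact hC x (subset_closure hx)

lemma contDiff_mem_H1 {U : Set (Sp d)} (hU : MeasurableSet U) (hUb : Bornology.IsBounded U)
    {u : Sp d → ℝ} (hu : ContDiff ℝ 1 u) : u ∈ H1 U :=
  ⟨Continuous.memLp_restrict_of_isBounded hU hUb hu.continuous 2, gradient u,
    Continuous.memLp_restrict_of_isBounded hU hUb (continuous_gradient hu) 2,
    hasWeakGrad_gradient U hu⟩

lemma H1_congr_ae {U : Set (Sp d)} {f f' : Sp d → ℝ} (hf : f ∈ H1 U)
    (h : f' =ᵐ[volume.restrict U] f) : f' ∈ H1 U :=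
  ⟨hf.1.ae_eq h.symm, hf.2.choose, hf.2.choose_spec.1, hf.2.choose_spec.2.congr_ae h⟩

lemma H1_add {U : Set (Sp d)} (hUb : Bornology.IsBounded U) {f f' : Sp d → ℝ} (hf : f ∈ H1 U)
    (hf' : f' ∈ H1 U) : f + f' ∈ H1 U := by
  obtain ⟨h, g, hg, hfg⟩ := hf
  obtain ⟨h', g', hg', hfg'⟩ := hf'
  exact ⟨h.add h', g + g', hg.add hg', hfg.add hUb h h' hg hg' hfg'⟩

lemma contDiff_affineMap (p : Sp d →ᵃ[ℝ] ℝ) : ContDiff ℝ 1 p := by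
  have : (p : Sp d → ℝ) = fun x => p.linear.toContinuousLinearMap x + p 0 := by
    funext x
    rw [p.decomp]; simp
  rw [this]
  fun_prop

lemma isBounded_interior_cell (T : Simp d) : Bornology.IsBounded (interior (cell T)) :=
  (isCompact_cell T).isBounded.subset interior_subset

lemma Mesh.mem_H1_of_mem_P1dc {Ω : Set (Sp d)} (M : Mesh Ω) {v : Sp d → ℝ} (hv : v ∈ M.P1dc)
    {T : Simp d} (hT : T ∈ M.cells) : v ∈ H1 (interior (cell T)) := by
  obtain ⟨p, hp⟩ := hv.2 T hT
  exact H1_congr_ae (contDiff_mem_H1 isOpen_interior.measurableSet (isBounded_interior_cell T)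
    (contDiff_affineMap p)) (ae_restrict_of_ae_restrict_of_subset interior_subset hp)

variable {m : ℕ}

/-- The choice behind `faceTrace` is not visibly additive, but its integral is: Green's formula
expresses it linearly through the function and any weak gradient. -/
lemma integral_faceTrace_add (T : Simp (m + 1)) (i : Fin (m + 1 + 1)) {f f' : Sp (m + 1) → ℝ}
    (hf : f ∈ H1 (interior (cell T))) (hf' : f' ∈ H1 (interior (cell T))) :
    ∫ x, faceTrace T i (f + f') x ∂(faceMeasure T i)
      = ∫ x, faceTrace T i f x ∂(faceMeasure T i) + ∫ x, faceTrace T i f' x ∂(faceMeasure T i) := by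
  obtain ⟨h, g, hg, hfg⟩ := hf
  obtain ⟨h', g', hg', hfg'⟩ := hf'
  have hb := isBounded_interior_cell T
  have e := integral_faceTrace T i h hg hfg
  have e' := integral_faceTrace T i h' hg' hfg'
  have es := integral_faceTrace T i (h.add h') (hg.add hg') (hfg.add hb h h' hg hg' hfg')
  have I := integrableOn_green T i h hg
  have I' := integrableOn_green T i h' hg'
  refine mul_left_cancel₀ (T.height_pos i).ne' ?_
  rw [mul_add, e, e', es]
  refine Eq.trans ?_ (integral_add (I.1.add I.2) (I'.1.add I'.2))
  refine integral_congr_ae (ae_of_all _ fun x => ?_)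
  simp only [Pi.add_apply, inner_add_right]
  ring

/-- For smooth functions the mean of the trace is the mean of the restriction. -/
lemma integral_faceTrace_of_contDiff (T : Simp (m + 1)) (i : Fin (m + 1 + 1))
    {u : Sp (m + 1) → ℝ} (hu : ContDiff ℝ 1 u) :
    ∫ x, faceTrace T i u x ∂(faceMeasure T i) = ∫ x, u x ∂(faceMeasure T i) := by
  refine mul_left_cancel₀ (T.height_pos i).ne' ?_
  rw [integral_faceTrace T i (Continuous.memLp_restrict_cell T hu.continuous 2)
    (Continuous.memLp_restrict_cell T (continuous_gradient hu) 2) (hasWeakGrad_gradient _ hu),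
    setIntegral_interior_cell, setIntegral_cell_green T i hu]

/-- Green's formula for the constant `1`. This makes the normalisation of the shape functions cancel
the height and leave a mean value. -/
lemma height_mul_faceMeasure (T : Simp (m + 1)) (i : Fin (m + 1 + 1)) :
    T.height i * (faceMeasure T i).real Set.univ = (m + 1) * volume.real (cell T) := by
  have h := setIntegral_cell_green T i (u := fun _ => 1) contDiff_const
  have hg : gradient (fun _ : Sp (m + 1) => (1 : ℝ)) = 0 := by
    funext x; simp [gradient]
  simp only [hg, Pi.zero_apply, inner_zero_right, mul_one, zero_add, integral_const, smul_eq_mul,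
    MeasurableSet.univ, measureReal_restrict_apply, Set.univ_inter] at h
  rw [← h, mul_comm]

lemma volume_real_cell_pos {d : ℕ} (T : Simp d) : 0 < volume.real (cell T) := by
  refine ENNReal.toReal_pos ?_ (volume_cell_lt_top T).ne
  exact ((isOpen_interior.measure_pos _ (interior_cell_nonempty T)).trans_le
    (measure_mono interior_subset)).ne'

end sobolev

/-! ### The Raviart--Thomas interpolant -/

section rt

variable {m : ℕ}

/-- The flux of a vector field through a face. -/
def faceFlux (T : Simp (m + 1)) (i : Fin (m + 1 + 1)) (w : Sp (m + 1) → Sp (m + 1)) : ℝ :=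
  ∫ y, normalTrace T i w y ∂(faceMeasure T i)

/-- The divergence of the local Raviart--Thomas interpolant. -/
def rtLocalDiv (T : Simp (m + 1)) (w : Sp (m + 1) → Sp (m + 1)) : ℝ :=
  ∑ i, faceFlux T i w * (((m + 1 : ℕ) : ℝ) * volume.real (cell T))⁻¹ * (m + 1)

lemma integrable_normalTrace (T : Simp (m + 1)) (i : Fin (m + 1 + 1))
    {w : Sp (m + 1) → Sp (m + 1)} (hw : w ∈ H1vec (interior (cell T))) :
    Integrable (normalTrace T i w) (faceMeasure T i) :=
  integrable_finsetSum _ fun j _ => (integrable_faceTrace T i (hw j)).mul_const _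

lemma faceFlux_eq (T : Simp (m + 1)) (i : Fin (m + 1 + 1))
    {w : Sp (m + 1) → Sp (m + 1)} (hw : w ∈ H1vec (interior (cell T))) :
    faceFlux T i w
      = ∑ j, (∫ x, faceTrace T i (fun y => w y j) x ∂(faceMeasure T i)) * normal T i j := by
  rw [faceFlux]
  simp only [normalTrace]
  rw [integral_finsetSum _ fun j _ => (integrable_faceTrace T i (hw j)).mul_const _]
  simp only [integral_mul_const]

lemma continuous_rtLocal (T : Simp (m + 1)) (w : Sp (m + 1) → Sp (m + 1)) :
    Continuous (rtLocal T w) := by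
  unfold rtLocal rtShape; fun_prop

/-- Green's formula for each field `x - P_i`, weighted by `flux_i / (d |T|)`, gives `flux_i · h_i /
(d |T|)` times the integral of the trace over the face, and `h_i / (d |T|)` is the reciprocal of the
area of that face. -/
lemma rtLocal_green (T : Simp (m + 1)) (w : Sp (m + 1) → Sp (m + 1))
    {f : Sp (m + 1) → ℝ} (hf : f ∈ H1 (interior (cell T))) :
    IntegrableOn (fun x => ⟪rtLocal T w x, weakGrad (interior (cell T)) f x⟫
      + rtLocalDiv T w * f x) (interior (cell T)) ∧
    ∫ x in interior (cell T), (⟪rtLocal T w x, weakGrad (interior (cell T)) f x⟫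
      + rtLocalDiv T w * f x) = ∑ i, faceFlux T i w * faceProj T i (faceTrace T i f) := by
  obtain ⟨hg, hfg⟩ := weakGrad_spec hf
  set κ : ℝ := (((m + 1 : ℕ) : ℝ) * volume.real (cell T))⁻¹ with hκ
  have hI := fun i => integrableOn_green T i hf.1 hg
  have e : (fun x => ⟪rtLocal T w x, weakGrad (interior (cell T)) f x⟫ + rtLocalDiv T w * f x)
      = fun x => ∑ i, faceFlux T i w * κ *
        (⟪x - T.points i, weakGrad (interior (cell T)) f x⟫ + (m + 1) * f x) := by
    funext x
    rw [rtLocal, rtLocalDiv, sum_inner, Finset.sum_mul, ← Finset.sum_add_distrib]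
    refine Finset.sum_congr rfl fun i _ => ?_
    rw [rtShape, inner_smul_left, inner_smul_left]
    simp only [RCLike.conj_to_real]
    change faceFlux T i w * (κ * _) + _ = _
    ring
  have hI' : ∀ i, Integrable (fun x => faceFlux T i w * κ *
        (⟪x - T.points i, weakGrad (interior (cell T)) f x⟫ + (m + 1) * f x))
      (volume.restrict (interior (cell T))) := fun i => ((hI i).1.add (hI i).2).const_mul _
  rw [e]
  refine ⟨integrable_finsetSum _ fun i _ => hI' i, ?_⟩
  rw [integral_finsetSum _ fun i _ => hI' i]
  refine Finset.sum_congr rfl fun i _ => ?_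
  rw [integral_const_mul, ← integral_faceTrace T i hf.1 hg hfg, faceProj, average_eq, smul_eq_mul,
    mul_assoc, ← mul_assoc κ]
  congr 2
  have h1 := height_mul_faceMeasure T i
  have h2 := volume_real_cell_pos T
  have h3 := T.height_pos i
  have h4 : (faceMeasure T i).real Set.univ ≠ 0 := by
    intro h0; rw [h0, mul_zero] at h1
    have : 0 < (m + 1 : ℝ) * volume.real (cell T) := by positivity
    linarith
  rw [hκ]
  push_cast
  rw [← h1]
  field_simp

end rt

/-! ### Global statements on a mesh -/

section global

lemma integrable_inner_of_memLp {d : ℕ} {μ : Measure (Sp d)} {f g : Sp d → Sp d}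
    (hf : MemLp f 2 μ) (hg : MemLp g 2 μ) : Integrable (fun x => ⟪f x, g x⟫) μ :=
  (hf.norm.integrable_mul hg.norm).mono' (hf.1.inner hg.1)
    (ae_of_all _ fun _ => norm_inner_le_norm _ _)

lemma Mesh.sum_indicator_eq {d : ℕ} {Ω : Set (Sp d)} (M : Mesh Ω) {E : Type*} [AddCommMonoid E]
    (F : Simp d → Sp d → E) {T : Simp d} (hT : T ∈ M.cells) {x : Sp d}
    (hx : x ∈ interior (cell T)) :
    ∑ T' ∈ M.cells, (interior (cell T')).indicator (F T') x = F T x := by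
  rw [Finset.sum_eq_single_of_mem T hT, Set.indicator_of_mem hx]
  intro T' hT' hne
  exact Set.indicator_of_notMem (Set.disjoint_left.1 (M.disjoint T hT T' hT' hne.symm) hx) _

/-- This is where the absence of slits enters: the interior of the union of two neighbouring
simplices lies in `Ω`, so an `H¹` function on `Ω` is `H¹` across their common face. -/
lemma IsPolyhedralDomain.interior_subset {d : ℕ} {Ω : Set (Sp d)} (hΩ : IsPolyhedralDomain Ω)
    {K : Set (Sp d)} (hK : K ⊆ closure Ω) : interior K ⊆ Ω := by
  rw [← hΩ.interior_closure]; exact interior_mono hK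

lemma Mesh.ae_eq_iUnion {d : ℕ} {Ω : Set (Sp d)} (hΩ : IsPolyhedralDomain Ω) (M : Mesh Ω) :
    Ω =ᵐ[volume] ⋃ T ∈ M.cells, interior (cell T) := by
  have hsub : ⋃ T ∈ M.cells, interior (cell T) ⊆ Ω :=
    Set.iUnion₂_subset fun T hT => hΩ.interior_subset (M.cell_subset hT)
  refine (ae_eq_of_subset_of_measure_ge hsub ?_ ?_ ?_).symm
  · refine (measure_mono (subset_closure.trans M.cover.le)).trans (le_of_eq ?_)
    exact measure_congr (Filter.EventuallyEq.countable_bUnion M.cells.countable_toSet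
      fun T _ => (interior_cell_ae_eq T).symm)
  · exact (MeasurableSet.biUnion M.cells.countable_toSet
      fun T _ => isOpen_interior.measurableSet).nullMeasurableSet
  · exact hΩ.isBounded.measure_lt_top.ne

variable {m : ℕ} {Ω : Set (Sp (m + 1))}

/-- The piecewise constant divergence of the Raviart--Thomas interpolant. -/
def Mesh.rtDiv (M : Mesh Ω) (w : Sp (m + 1) → Sp (m + 1)) : Sp (m + 1) → ℝ :=
  fun x => ∑ T ∈ M.cells, (interior (cell T)).indicator (fun _ => rtLocalDiv T w) x

lemma Mesh.memLp_sum_indicator (M : Mesh Ω) {E : Type*} [NormedAddCommGroup E]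
    {F : Simp (m + 1) → Sp (m + 1) → E} (hF : ∀ T, Continuous (F T)) :
    MemLp (fun x => ∑ T ∈ M.cells, (interior (cell T)).indicator (F T) x) 2
      (volume.restrict Ω) := by
  refine memLp_finsetSum _ fun T _ => ?_
  have h : MemLp ((interior (cell T)).indicator (F T)) 2 volume :=
    (memLp_indicator_iff_restrict isOpen_interior.measurableSet).2
      (Continuous.memLp_restrict_cell T (hF T) 2)
  exact h.mono_measure Measure.restrict_le_self

lemma Mesh.memLp_rtInterp (M : Mesh Ω) (w : Sp (m + 1) → Sp (m + 1)) :
    MemLp (M.rtInterp w) 2 (volume.restrict Ω) :=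
  M.memLp_sum_indicator fun T => continuous_rtLocal T w

lemma Mesh.memLp_rtDiv (M : Mesh Ω) (w : Sp (m + 1) → Sp (m + 1)) :
    MemLp (M.rtDiv w) 2 (volume.restrict Ω) :=
  M.memLp_sum_indicator fun _ => continuous_const

/-- Componentwise the trace integrals agree from both sides, while the constant normals are
opposite. -/
lemma faceFlux_eq_neg_of_face_eq {T T' : Simp (m + 1)} {i i' : Fin (m + 1 + 1)}
    (hF : face T i = face T' i') (hdis : Disjoint (interior (cell T)) (interior (cell T')))
    {w : Sp (m + 1) → Sp (m + 1)} (hw : w ∈ H1vec (interior (cell T ∪ cell T'))) :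
    faceFlux T' i' w = -faceFlux T i w := by
  rw [faceFlux_eq T' i' fun j => H1_mono (interior_mono Set.subset_union_right) (hw j),
    faceFlux_eq T i fun j => H1_mono (interior_mono Set.subset_union_left) (hw j),
    ← Finset.sum_neg_distrib]
  refine Finset.sum_congr rfl fun j _ => ?_
  rw [integral_faceTrace_eq_of_face_eq hF hdis (hw j), normal_eq_neg_of_face_eq hF hdis]
  simp

/-- Integration by parts for the Raviart--Thomas interpolant against piecewise `H¹` functions
whose mean values on interior faces agree. -/
theorem Mesh.rtInterp_green (hΩ : IsPolyhedralDomain Ω) (M : Mesh Ω)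
    {w : Sp (m + 1) → Sp (m + 1)} (hw : w ∈ H1vec Ω) {ψ : Sp (m + 1) → ℝ}
    (hψ : ∀ T ∈ M.cells, ψ ∈ H1 (interior (cell T)))
    (hjump : ∀ T ∈ M.cells, ∀ T' ∈ M.cells, T ≠ T' → ∀ i i', face T i = face T' i' →
      ∫ x, faceTrace T i ψ x ∂(faceMeasure T i) = ∫ x, faceTrace T' i' ψ x ∂(faceMeasure T' i')) :
    IntegrableOn (fun x => ⟪M.rtInterp w x, M.brokenGrad ψ x⟫ + M.rtDiv w x * ψ x) Ω ∧
    ∫ x in Ω, (⟪M.rtInterp w x, M.brokenGrad ψ x⟫ + M.rtDiv w x * ψ x)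
      = ∑ F ∈ M.boundaryFaces, faceFlux F.1 F.2 w * faceProj F.1 F.2 (faceTrace F.1 F.2 ψ) := by
  have hon : ∀ T ∈ M.cells, Set.EqOn
      (fun x => ⟪rtLocal T w x, weakGrad (interior (cell T)) ψ x⟫ + rtLocalDiv T w * ψ x)
      (fun x => ⟪M.rtInterp w x, M.brokenGrad ψ x⟫ + M.rtDiv w x * ψ x) (interior (cell T)) := by
    intro T hT x hx
    simp only [Mesh.rtInterp, Mesh.brokenGrad, Mesh.rtDiv]
    rw [M.sum_indicator_eq (fun T => rtLocal T w) hT hx,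
      M.sum_indicator_eq (fun T => weakGrad (interior (cell T)) ψ) hT hx,
      M.sum_indicator_eq (fun T _ => rtLocalDiv T w) hT hx]
  have hint : ∀ T ∈ M.cells, IntegrableOn
      (fun x => ⟪M.rtInterp w x, M.brokenGrad ψ x⟫ + M.rtDiv w x * ψ x) (interior (cell T)) :=
    fun T hT => (rtLocal_green T w (hψ T hT)).1.congr_fun (hon T hT) isOpen_interior.measurableSet
  constructor
  · rw [integrableOn_congr_set_ae (M.ae_eq_iUnion hΩ), integrableOn_finset_iUnion]
    exact hint
  rw [setIntegral_congr_set (M.ae_eq_iUnion hΩ), integral_biUnion_finset _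
    (fun T _ => isOpen_interior.measurableSet)
    (fun T hT T' hT' hne => M.disjoint T hT T' hT' hne) hint,
    ← M.sum_faces_eq_sum_boundaryFaces hΩ.isOpen
      (fun T i => faceFlux T i w * faceProj T i (faceTrace T i ψ))]
  · refine Finset.sum_congr rfl fun T hT => ?_
    rw [← setIntegral_congr_fun isOpen_interior.measurableSet (hon T hT)]
    exact (rtLocal_green T w (hψ T hT)).2
  -- On a shared face the fluxes are opposite and the means of `ψ` are equal.
  · intro T hT T' hT' hne i i' hF
    have hsub : interior (cell T ∪ cell T') ⊆ Ω :=
      hΩ.interior_subset (Set.union_subset (M.cell_subset hT) (M.cell_subset hT'))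
    rw [faceFlux_eq_neg_of_face_eq hF (M.disjoint T hT T' hT' hne) fun j => H1_mono hsub (hw j),
      faceProj, faceProj, average_eq, average_eq, hjump T hT T' hT' hne i i' hF,
      faceMeasure_eq_of_face_eq hF]
    ring

lemma Mesh.mem_H1_cell (hΩ : IsPolyhedralDomain Ω) (M : Mesh Ω) {f : Sp (m + 1) → ℝ}
    (hf : f ∈ H1 Ω) {T : Simp (m + 1)} (hT : T ∈ M.cells) : f ∈ H1 (interior (cell T)) :=
  H1_mono (hΩ.interior_subset (M.cell_subset hT)) hf

lemma Mesh.integral_faceTrace_eq (hΩ : IsPolyhedralDomain Ω) (M : Mesh Ω) {f : Sp (m + 1) → ℝ}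
    (hf : f ∈ H1 Ω) {T T' : Simp (m + 1)} (hT : T ∈ M.cells) (hT' : T' ∈ M.cells) (hne : T ≠ T')
    {i i' : Fin (m + 1 + 1)} (hF : face T i = face T' i') :
    ∫ x, faceTrace T i f x ∂(faceMeasure T i) = ∫ x, faceTrace T' i' f x ∂(faceMeasure T' i') :=
  integral_faceTrace_eq_of_face_eq hF (M.disjoint T hT T' hT' hne)
    (H1_mono (hΩ.interior_subset
      (Set.union_subset (M.cell_subset hT) (M.cell_subset hT'))) hf)

lemma Mesh.brokenGrad_ae_eq_gradient (hΩ : IsPolyhedralDomain Ω) (M : Mesh Ω)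
    {u : Sp (m + 1) → ℝ} (hu : ContDiff ℝ 1 u) :
    M.brokenGrad u =ᵐ[volume.restrict Ω] gradient u := by
  rw [Measure.restrict_congr_set (M.ae_eq_iUnion hΩ)]
  refine (ae_restrict_biUnion_finset_iff _ _ _).2 fun T hT => ?_
  have hH := contDiff_mem_H1 isOpen_interior.measurableSet (isBounded_interior_cell T) hu
  filter_upwards [ae_restrict_mem isOpen_interior.measurableSet,
    HasWeakGrad.ae_eq isOpen_interior (isBounded_interior_cell T) (weakGrad_spec hH).1
      (Continuous.memLp_restrict_cell T (continuous_gradient hu) 2) (weakGrad_spec hH).2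
      (hasWeakGrad_gradient _ hu)] with x hx hx'
  rw [Mesh.brokenGrad, M.sum_indicator_eq (fun T => weakGrad (interior (cell T)) u) hT hx, hx']

lemma Mesh.mem_cells_of_mem_boundaryFaces (M : Mesh Ω) {F : Simp (m + 1) × Fin (m + 1 + 1)}
    (hF : F ∈ M.boundaryFaces) : F.1 ∈ M.cells ∧ face F.1 F.2 ⊆ frontier Ω := by
  classical
  simp only [Mesh.boundaryFaces, Finset.mem_filter, Finset.mem_product] at hF
  exact ⟨hF.1.1, hF.2⟩

/-- Green's formula on the mesh with the test function in place of `ψ`: the boundary terms vanish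
because the support lies in `Ω`, and the broken gradient is the classical one almost everywhere. -/
theorem Mesh.hasWeakDiv_rtDiv (hΩ : IsPolyhedralDomain Ω) (M : Mesh Ω)
    {w : Sp (m + 1) → Sp (m + 1)} (hw : w ∈ H1vec Ω) :
    HasWeakDiv Ω (M.rtInterp w) (M.rtDiv w) := by
  intro φ hφ
  have : IsFiniteMeasure (volume.restrict Ω) := ⟨by simpa using hΩ.isBounded.measure_lt_top⟩
  have hφ1 : ContDiff ℝ 1 φ := hφ.1.of_le (by simp)
  have hH : φ ∈ H1 Ω := contDiff_mem_H1 hΩ.isOpen.measurableSet hΩ.isBounded hφ1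
  have hgreen := (M.rtInterp_green hΩ hw (fun T hT => M.mem_H1_cell hΩ hH hT)
    fun T hT T' hT' hne i i' hF => M.integral_faceTrace_eq hΩ hH hT hT' hne hF).2
  rw [Finset.sum_eq_zero] at hgreen
  · have h1 : ∫ x in Ω, (⟪M.rtInterp w x, M.brokenGrad φ x⟫ + M.rtDiv w x * φ x)
        = ∫ x in Ω, (⟪M.rtInterp w x, gradient φ x⟫ + M.rtDiv w x * φ x) := by
      refine integral_congr_ae ?_
      filter_upwards [M.brokenGrad_ae_eq_gradient hΩ hφ1] with x hx
      rw [hx]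
    have i1 : Integrable (fun x => ⟪M.rtInterp w x, gradient φ x⟫) (volume.restrict Ω) :=
      integrable_inner_of_memLp (M.memLp_rtInterp w) (Continuous.memLp_restrict_of_isBounded
        hΩ.isOpen.measurableSet hΩ.isBounded (continuous_gradient hφ1) 2)
    have i2 : Integrable (fun x => M.rtDiv w x * φ x) (volume.restrict Ω) :=
      (M.memLp_rtDiv w).integrable_mul hH.1
    rw [h1, integral_add i1 i2] at hgreen
    linarith
  · intro F hF
    have hfr := (M.mem_cells_of_mem_boundaryFaces hF).2
    rw [faceProj, average_eq, integral_faceTrace_of_contDiff F.1 F.2 hφ1]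
    have h0 : ∫ x, φ x ∂(faceMeasure F.1 F.2) = 0 := by
      refine integral_eq_zero_of_ae ?_
      filter_upwards [ae_restrict_mem (isCompact_face F.1 F.2).measurableSet] with x hx
      refine hφ.eq_zero fun hxΩ => ?_
      have := hfr hx
      rw [hΩ.isOpen.frontier_eq] at this
      exact this.2 hxΩ
    rw [h0, smul_zero, mul_zero]

lemma weakDiv_spec {d : ℕ} {U : Set (Sp d)} {v : Sp d → Sp d} {q : Sp d → ℝ}
    (hq : MemLp q 2 (volume.restrict U)) (h : HasWeakDiv U v q) :
    MemLp (weakDiv U v) 2 (volume.restrict U) ∧ HasWeakDiv U v (weakDiv U v) := by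
  have hex : ∃ q : Sp d → ℝ, MemLp q 2 (volume.restrict U) ∧ HasWeakDiv U v q := ⟨q, hq, h⟩
  rw [weakDiv, dif_pos hex]
  exact hex.choose_spec

lemma weakDiv_ae_eq {d : ℕ} {U : Set (Sp d)} (hU : IsOpen U) (hUb : Bornology.IsBounded U)
    {v : Sp d → Sp d} {q : Sp d → ℝ} (hq : MemLp q 2 (volume.restrict U)) (h : HasWeakDiv U v q) :
    weakDiv U v =ᵐ[volume.restrict U] q := by
  obtain ⟨hq', h'⟩ := weakDiv_spec hq h
  refine ae_eq_of_forall_test hU hUb hq' hq fun φ hφ => ?_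
  simp only [smul_eq_mul, mul_comm (φ _)]
  exact neg_injective ((h' φ hφ).symm.trans (h φ hφ))

lemma Mesh.mem_H1_of_mem_add (hΩ : IsPolyhedralDomain Ω) (M : Mesh Ω) {ψ : Sp (m + 1) → ℝ}
    (hψ : ψ ∈ M.VCR + H1 Ω) {T : Simp (m + 1)} (hT : T ∈ M.cells) :
    ψ ∈ H1 (interior (cell T)) := by
  obtain ⟨v, hv, u, hu, rfl⟩ := Set.mem_add.1 hψ
  exact H1_add (isBounded_interior_cell T) (M.mem_H1_of_mem_P1dc hv.1 hT) (M.mem_H1_cell hΩ hu hT)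

/-- The Crouzeix–Raviart part has jumps of mean zero by definition and the `H¹` part has equal trace
integrals from both sides; additivity of the trace integrals combines them. -/
lemma Mesh.integral_faceTrace_eq_of_mem_add (hΩ : IsPolyhedralDomain Ω) (M : Mesh Ω)
    {ψ : Sp (m + 1) → ℝ} (hψ : ψ ∈ M.VCR + H1 Ω) {T T' : Simp (m + 1)} (hT : T ∈ M.cells)
    (hT' : T' ∈ M.cells) (hne : T ≠ T') {i i' : Fin (m + 1 + 1)} (hF : face T i = face T' i') :
    ∫ x, faceTrace T i ψ x ∂(faceMeasure T i) = ∫ x, faceTrace T' i' ψ x ∂(faceMeasure T' i') := by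
  obtain ⟨v, hv, u, hu, rfl⟩ := Set.mem_add.1 hψ
  have hvT := M.mem_H1_of_mem_P1dc hv.1 hT
  have hvT' := M.mem_H1_of_mem_P1dc hv.1 hT'
  rw [integral_faceTrace_add T i hvT (M.mem_H1_cell hΩ hu hT),
    integral_faceTrace_add T' i' hvT' (M.mem_H1_cell hΩ hu hT'),
    M.integral_faceTrace_eq hΩ hu hT hT' hne hF]
  congr 1
  have h := hv.2 T hT T' hT' hne i i' hF
  rw [integral_sub (integrable_faceTrace T i hvT)
    (by rw [faceMeasure_eq_of_face_eq hF]; exact integrable_faceTrace T' i' hvT'), sub_eq_zero] at h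
  rw [h, faceMeasure_eq_of_face_eq hF]

end global

end CRRT

end

/-! ### The integration by parts identity for the Raviart–Thomas interpolant. -/

theorem mainTheorem8 {d : ℕ} [NeZero d] (hd : d = 2 ∨ d = 3)
    {Ω : Set (CRRT.Sp d)} (hΩ : CRRT.IsPolyhedralDomain Ω) (M : CRRT.Mesh Ω)
    (w : CRRT.Sp d → CRRT.Sp d) (hw : w ∈ CRRT.H1vec Ω)
    (ψ : CRRT.Sp d → ℝ) (hψ : ψ ∈ M.VCR + CRRT.H1 Ω) :
    (MemLp (M.rtInterp w) 2 (volume.restrict Ω) ∧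
      MemLp (CRRT.weakDiv Ω (M.rtInterp w)) 2 (volume.restrict Ω) ∧
      CRRT.HasWeakDiv Ω (M.rtInterp w) (CRRT.weakDiv Ω (M.rtInterp w))) ∧
    IntegrableOn (fun x => ⟪M.rtInterp w x, M.brokenGrad ψ x⟫
      + CRRT.weakDiv Ω (M.rtInterp w) x * ψ x) Ω ∧
    (∀ F ∈ M.boundaryFaces,
      Integrable (fun x => CRRT.normalTrace F.1 F.2 w x
        * CRRT.faceProj F.1 F.2 (CRRT.faceTrace F.1 F.2 ψ)) (CRRT.faceMeasure F.1 F.2)) ∧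
    ∫ x in Ω, (⟪M.rtInterp w x, M.brokenGrad ψ x⟫
        + CRRT.weakDiv Ω (M.rtInterp w) x * ψ x)
      = ∑ F ∈ M.boundaryFaces, ∫ x, CRRT.normalTrace F.1 F.2 w x
          * CRRT.faceProj F.1 F.2 (CRRT.faceTrace F.1 F.2 ψ) ∂(CRRT.faceMeasure F.1 F.2) := by
  obtain ⟨m, rfl⟩ : ∃ m, d = m + 1 := Nat.exists_eq_succ_of_ne_zero (NeZero.ne d)
  have hdiv := M.hasWeakDiv_rtDiv hΩ hw
  have hae := CRRT.weakDiv_ae_eq hΩ.isOpen hΩ.isBounded (M.memLp_rtDiv w) hdiv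
  obtain ⟨hint, hgreen⟩ := M.rtInterp_green hΩ hw (fun T hT => M.mem_H1_of_mem_add hΩ hψ hT)
    fun T hT T' hT' hne i i' hF => M.integral_faceTrace_eq_of_mem_add hΩ hψ hT hT' hne hF
  -- Uniqueness of the weak divergence allows the piecewise constant one from Green's formula to be
  -- replaced by `weakDiv`.
  have hcongr : (fun x => ⟪M.rtInterp w x, M.brokenGrad ψ x⟫ + M.rtDiv w x * ψ x)
      =ᵐ[volume.restrict Ω] fun x => ⟪M.rtInterp w x, M.brokenGrad ψ x⟫
        + CRRT.weakDiv Ω (M.rtInterp w) x * ψ x := by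
    filter_upwards [hae] with x hx
    rw [hx]
  refine ⟨⟨M.memLp_rtInterp w, CRRT.weakDiv_spec (M.memLp_rtDiv w) hdiv⟩, hint.congr hcongr,
    fun F hF => ?_, ?_⟩
  · exact (CRRT.integrable_normalTrace F.1 F.2 fun j => M.mem_H1_cell hΩ (hw j)
      (M.mem_cells_of_mem_boundaryFaces hF).1).mul_const _
  · rw [← integral_congr_ae hcongr, hgreen]
    exact Finset.sum_congr rfl fun F _ => (integral_mul_const _ _).symm
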